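/- Let $\mathscr S$ be the class of compactly generated locally compact groups that are totally disconnected, topologically simple and non-discrete. A \emph{locally normal} subgroup of a topological group $G$ is a compact subgroup of $G$ whose normaliser is open in $G$. For a set $\eta$ of primes, a pro-$\eta$ group is a profinite group all of whose quotients by open normal subgroups have order divisible only by primes in $\eta$; a pro-soluble group is a profinite group all of whose quotients by open normal subgroups are soluble; pro-$p$ means pro-$\{p\}$. A group has a property virtually if some subgroup of finite index has it (for subgroups of topological groups, with the induced topology). \textbf{Theorem.} Let $G \in \mathscr S$. Then: (i) There is a finite set of primes $\eta = \eta(G)$ such that every locally normal subgroup of $G$ is virtually pro-$\eta$. Moreover, the open pro-$\eta$ subgroups of $G$ form a basis of identity neighbourhoods. (ii) For every $p \in \eta$, with the same set $\eta$ as in (i), every locally normal subgroup $L \neq \{e\}$ of $G$ has an infinite pro-$p$ subgroup. (iii) If some non-trivial locally normal subgroup of $G$ is virtually pro-soluble, then so is every compact open subgroup of $G$. (iv) The only virtually soluble locally normal subgroup of $G$ is the trivial subgroup $\{e\}$. -/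

import Mathlib

open Topology

/-- A topological group is topologically simple if it is nontrivial and its only closed normal
subgroups are the trivial subgroup and the whole group. -/
def IsTopologicallySimple (G : Type*) [Group G] [TopologicalSpace G] : Prop :=
  Nontrivial G ∧
    ∀ N : Subgroup G, N.Normal → IsClosed (N : Set G) → N = ⊥ ∨ N = ⊤

/-- A topological group is compactly generated if it is generated, as an abstract group, by a
compact subset. -/
def IsCompactlyGeneratedGroup (G : Type*) [Group G] [TopologicalSpace G] : Prop :=
  ∃ K : Set G, IsCompact K ∧ Subgroup.closure K = ⊤

/-- The class `𝒮` of compactly generated locally compact groups that are totally disconnected,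
topologically simple and non-discrete. (A totally disconnected topological group is Hausdorff.) -/
structure InClassS (G : Type*) [Group G] [TopologicalSpace G] [IsTopologicalGroup G] : Prop where
  locallyCompact : LocallyCompactSpace G
  compactlyGenerated : IsCompactlyGeneratedGroup G
  totallyDisconnected : TotallyDisconnectedSpace G
  topologicallySimple : IsTopologicallySimple G
  nonDiscrete : ¬ DiscreteTopology G

/-- A locally normal subgroup: a compact subgroup whose normaliser is open. -/
def IsLocallyNormal {G : Type*} [Group G] [TopologicalSpace G] (L : Subgroup G) : Prop :=
  IsCompact (L : Set G) ∧ IsOpen (Subgroup.normalizer (L : Set G) : Set G)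

/-- A topological group is profinite if it is compact and totally disconnected. -/
def IsProfiniteGroup (H : Type*) [Group H] [TopologicalSpace H] [IsTopologicalGroup H] : Prop :=
  CompactSpace H ∧ TotallyDisconnectedSpace H

/-- A pro-`η` group: a profinite group such that all primes dividing the order of a quotient by an
open normal subgroup (which is finite by compactness) lie in `η`. -/
def IsPro (η : Set ℕ) (H : Type*) [Group H] [TopologicalSpace H] [IsTopologicalGroup H] : Prop :=
  IsProfiniteGroup H ∧
    ∀ N : Subgroup H, N.Normal → IsOpen (N : Set H) →
      ∀ p : ℕ, p.Prime → p ∣ Nat.card (H ⧸ N) → p ∈ η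

/-- A prosoluble group: a profinite group all of whose quotients by open normal subgroups are
soluble. -/
def IsProsoluble (H : Type*) [Group H] [TopologicalSpace H] [IsTopologicalGroup H] : Prop :=
  IsProfiniteGroup H ∧
    ∀ (N : Subgroup H) [N.Normal], IsOpen (N : Set H) → Group.IsSolvable (H ⧸ N)

/-- Virtually pro-`η`: some subgroup of finite index is pro-`η`. In a Hausdorff group such a
subgroup, being compact, is closed, and so it is open. -/
def IsVirtuallyPro (η : Set ℕ) (H : Type*) [Group H] [TopologicalSpace H]
    [IsTopologicalGroup H] : Prop :=
  ∃ V : Subgroup H, V.FiniteIndex ∧ IsPro η V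

/-- Virtually prosoluble: some subgroup of finite index is prosoluble. In a Hausdorff group such a
subgroup, being compact, is closed, and so it is open. -/
def IsVirtuallyProsoluble (H : Type*) [Group H] [TopologicalSpace H]
    [IsTopologicalGroup H] : Prop :=
  ∃ V : Subgroup H, V.FiniteIndex ∧ IsProsoluble V

/-- Virtually soluble: some subgroup of finite index is soluble. -/
def IsVirtuallySoluble (H : Type*) [Group H] : Prop :=
  ∃ V : Subgroup H, V.FiniteIndex ∧ Group.IsSolvable V

-- Let K be a nontrivial compact subgroup, commensurated in G and normalised by a compact open
-- subgroup U containing it. The elements whose commutators with everything near 1 lie in K form a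
-- normal subgroup containing K. By simplicity it is dense, so by compact generation it contains a
-- finite set S = S⁻¹ with G = ⟨S, U⟩. By compactness Ω, the union of the K(usu⁻¹)K with u in U and
-- s in S, is finitely many cosets tK. Hence the subgroup Q of those x in K with s⁻¹xs in K for all
-- s in Ω is open in K, and some open V ≤ U has its commutators with Ω in K.
--
-- Let X be a class closed under subgroups, quotients and extensions with K/Q in X. If a closed
-- normal subgroup R of V has no nontrivial continuous X-quotient, induction along words in Ω keeps
-- all conjugates of R inside U. So R lies in the normal core of U, which is compact and normal,
-- hence trivial; this forces V to be pro-X (`InClassS.exists_open_isProClass`,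
-- `IsProClass.of_perfect_eq_bot`).
--
-- Taking K = U bounds the primes involved. For a locally normal L ≠ 1, small pieces of finitely
-- many conjugates of L generate a commensurated K that is pro-X when small pieces of L are; so
-- local X-properties of L pass to open subgroups of G. With η the primes p for which no open
-- subgroup is pro-p', this yields (iii), and (ii) by Sylow theory. For (iv), derived subgroups
-- reduce to abelian L. Then something nontrivial centralises K, and the generation argument makes K
-- discrete, against triviality of the quasi-centre.

universe u

/-! ### Classes of groups closed under subgroups, quotients and extensions -/

/-- A class of groups containing the trivial groups and closed under subgroups and extensions of
quotients. -/
structure IsGroupClass (X : ∀ (H : Type u) [Group H], Prop) : Prop where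
  of_subsingleton : ∀ (A : Type u) [Group A] [Subsingleton A], X A
  of_injective : ∀ {A B : Type u} [Group A] [Group B] (f : A →* B),
    Function.Injective f → X B → X A
  of_ker_le_range : ∀ {A H B : Type u} [Group A] [Group H] [Group B] (g : A →* H) (f : H →* B),
    f.ker ≤ g.range → X A → X B → X H

/-- A profinite group whose quotients by open normal subgroups lie in the class `X`. -/
def IsProClass (X : ∀ (H : Type u) [Group H], Prop) (H : Type u) [Group H] [TopologicalSpace H]
    [IsTopologicalGroup H] : Prop :=
  IsProfiniteGroup H ∧ ∀ (N : Subgroup H) [N.Normal], IsOpen (N : Set H) → X (H ⧸ N)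

namespace IsGroupClass

variable {X : ∀ (H : Type u) [Group H], Prop}

theorem of_surjective (hX : IsGroupClass X) {A B : Type u} [Group A] [Group B] (f : A →* B)
    (hf : Function.Surjective f) (hA : X A) : X B :=
  hX.of_ker_le_range f (1 : B →* PUnit.{u + 1})
    (by rw [MonoidHom.range_eq_top.2 hf]; exact le_top) hA (hX.of_subsingleton _)

theorem prod (hX : IsGroupClass X) {A B : Type u} [Group A] [Group B] (hA : X A) (hB : X B) :
    X (A × B) :=
  hX.of_ker_le_range (MonoidHom.inl A B) (MonoidHom.snd A B)
    (fun x hx => ⟨x.1, Prod.ext rfl hx.symm⟩) hA hB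

theorem quotient_of_le (hX : IsGroupClass X) {A : Type u} [Group A] {M N : Subgroup A}
    [M.Normal] [N.Normal] (h : M ≤ N) (hM : X (A ⧸ M)) : X (A ⧸ N) :=
  hX.of_surjective (QuotientGroup.map M N (MonoidHom.id A) h)
    (fun y => by
      obtain ⟨x, rfl⟩ := QuotientGroup.mk_surjective y
      exact ⟨x, rfl⟩) hM

theorem quotient_inf (hX : IsGroupClass X) {A : Type u} [Group A] {M N : Subgroup A}
    [M.Normal] [N.Normal] (hM : X (A ⧸ M)) (hN : X (A ⧸ N)) : X (A ⧸ (M ⊓ N)) := by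
  refine hX.of_injective
    (QuotientGroup.lift (M ⊓ N) ((QuotientGroup.mk' M).prod (QuotientGroup.mk' N)) ?_) ?_
    (hX.prod hM hN)
  · intro x hx
    rw [MonoidHom.mem_ker, MonoidHom.prod_apply]
    exact Prod.ext ((QuotientGroup.eq_one_iff x).2 hx.1) ((QuotientGroup.eq_one_iff x).2 hx.2)
  · rw [injective_iff_map_eq_one]
    intro y hy
    obtain ⟨x, rfl⟩ := QuotientGroup.mk_surjective y
    rw [QuotientGroup.lift_mk, MonoidHom.prod_apply, Prod.mk_eq_one] at hy
    exact (QuotientGroup.eq_one_iff x).2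
      ⟨(QuotientGroup.eq_one_iff x).1 hy.1, (QuotientGroup.eq_one_iff x).1 hy.2⟩

theorem quotient_finset_inf (hX : IsGroupClass X) {A : Type u} [Group A] {ι : Type*}
    (N : ι → Subgroup A) (hN : ∀ i, (N i).Normal) (hXN : ∀ i, X (A ⧸ N i)) (t : Finset ι) :
    ∃ M : Subgroup A, ∃ _ : M.Normal, (∀ x, x ∈ M ↔ ∀ i ∈ t, x ∈ N i) ∧ X (A ⧸ M) := by
  classical
  induction t using Finset.induction_on with
  | empty =>
    refine ⟨⊤, inferInstance, by simp, ?_⟩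
    have := QuotientGroup.subsingleton_quotient_top (G := A)
    exact hX.of_subsingleton _
  | insert i t _ ih =>
    obtain ⟨M, hM, hMt, hXM⟩ := ih
    have := hN i
    refine ⟨N i ⊓ M, inferInstance, ?_, hX.quotient_inf (hXN i) hXM⟩
    intro x
    rw [Subgroup.mem_inf, hMt]
    simp

/-- In a compact group, the quotient by a closed-and-open normal subgroup containing an
intersection of closed normal subgroups with quotients in `X` has its quotient in `X`. -/
theorem quotient_of_iInf_le (hX : IsGroupClass X) {A : Type u} [Group A] [TopologicalSpace A]
    [CompactSpace A] {ι : Type*} (N : ι → Subgroup A) (hN : ∀ i, (N i).Normal)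
    (hXN : ∀ i, X (A ⧸ N i)) (hc : ∀ i, IsClosed (N i : Set A)) (O : Subgroup A) [O.Normal]
    (hO : IsOpen (O : Set A)) (hle : ∀ x, (∀ i, x ∈ N i) → x ∈ O) : X (A ⧸ O) := by
  obtain ⟨t, ht⟩ := hO.isClosed_compl.isCompact.elim_finite_subfamily_closed
    (fun i => (N i : Set A)) hc (by
      rw [Set.eq_empty_iff_forall_notMem]
      rintro x ⟨hx, hx'⟩
      exact hx (hle x (by simpa using hx')))
  obtain ⟨M, hM, hMt, hXM⟩ := hX.quotient_finset_inf N hN hXN t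
  refine hX.quotient_of_le (M := M) (fun x hx => ?_) hXM
  by_contra hxO
  exact Set.eq_empty_iff_forall_notMem.1 ht x ⟨hxO, by simpa using (hMt x).1 hx⟩

end IsGroupClass

/-! ### Pro-X groups -/

theorem exists_open_normal_le {H : Type*} [Group H] [TopologicalSpace H] [IsTopologicalGroup H]
    [CompactSpace H] [TotallyDisconnectedSpace H] {V : Set H} (hV : V ∈ 𝓝 (1 : H)) :
    ∃ N : Subgroup H, N.Normal ∧ IsOpen (N : Set H) ∧ (N : Set H) ⊆ V := by
  obtain ⟨O, hOV, hO, h1⟩ := mem_nhds_iff.1 hV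
  obtain ⟨N, hN⟩ := ProfiniteGrp.exist_openNormalSubgroup_sub_open_nhds_of_one hO h1
  exact ⟨N.toSubgroup, N.isNormal', N.isOpen', hN.trans hOV⟩

namespace IsProClass

variable {X : ∀ (H : Type u) [Group H], Prop}

/-- By compactness A carries the topology induced from B, so N contains the preimage of some open
normal M of B, and A modulo that preimage embeds in B/M. -/
theorem of_injective (hX : IsGroupClass X) {A B : Type u} [Group A] [Group B]
    [TopologicalSpace A] [TopologicalSpace B] [IsTopologicalGroup A] [IsTopologicalGroup B]
    [CompactSpace A] (f : A →* B) (hfc : Continuous f) (hf : Function.Injective f)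
    (hB : IsProClass X B) : IsProClass X A := by
  obtain ⟨⟨hB1, hB2⟩, hB3⟩ := hB
  have hemb := (hfc.isClosedEmbedding hf)
  have hA2 : TotallyDisconnectedSpace A :=
    ⟨isTotallyDisconnected_of_image hfc.continuousOn hf
      (isTotallyDisconnected_of_totallyDisconnectedSpace _)⟩
  refine ⟨⟨inferInstance, hA2⟩, fun N hN hNo => ?_⟩
  have h1 : (N : Set A) ∈ 𝓝 (1 : A) := hNo.mem_nhds N.one_mem
  rw [hemb.isInducing.nhds_eq_comap, map_one] at h1
  obtain ⟨V, hV, hVN⟩ := h1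
  obtain ⟨M, hM, hMo, hMV⟩ := exists_open_normal_le hV
  refine hX.quotient_of_le (M := M.comap f) (fun x hx => hVN (hMV hx)) ?_
  refine hX.of_injective (QuotientGroup.map (M.comap f) M f le_rfl) ?_ (hB3 M hMo)
  rw [injective_iff_map_eq_one]
  intro y hy
  obtain ⟨x, rfl⟩ := QuotientGroup.mk_surjective y
  rw [QuotientGroup.map_mk, QuotientGroup.eq_one_iff] at hy
  exact (QuotientGroup.eq_one_iff x).2 hy

theorem of_surjective (hX : IsGroupClass X) {A B : Type u} [Group A] [Group B]
    [TopologicalSpace A] [TopologicalSpace B] [IsTopologicalGroup A] [IsTopologicalGroup B]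
    [TotallyDisconnectedSpace B] (f : A →* B) (hfc : Continuous f) (hf : Function.Surjective f)
    (hA : IsProClass X A) : IsProClass X B := by
  obtain ⟨⟨hA1, hA2⟩, hA3⟩ := hA
  refine ⟨⟨hf.compactSpace hfc, inferInstance⟩, fun N hN hNo => ?_⟩
  refine hX.of_surjective (QuotientGroup.map (N.comap f) N f le_rfl) (fun y => ?_)
    (hA3 (N.comap f) (hNo.preimage hfc))
  obtain ⟨x, rfl⟩ := QuotientGroup.mk_surjective y
  obtain ⟨z, rfl⟩ := hf x
  exact ⟨z, rfl⟩

section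

variable {G : Type u} [Group G] [TopologicalSpace G] [IsTopologicalGroup G]

theorem isCompact {M : Subgroup G} (h : IsProClass X M) : IsCompact (M : Set G) :=
  isCompact_iff_compactSpace.2 h.1.1

theorem mono (hX : IsGroupClass X) {M N : Subgroup G} (h : IsProClass X N) (hMN : M ≤ N)
    (hM : IsCompact (M : Set G)) : IsProClass X M :=
  have : CompactSpace M := isCompact_iff_compactSpace.1 hM
  of_injective hX (Subgroup.inclusion hMN) (continuous_inclusion hMN)
    (Subgroup.inclusion_injective hMN) h

theorem map (hX : IsGroupClass X) [TotallyDisconnectedSpace G] {M : Subgroup G}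
    (h : IsProClass X M) (f : G →* G) (hf : Continuous f) : IsProClass X (M.map f) :=
  of_surjective hX (f.subgroupMap M) (by
    exact Continuous.subtype_mk (hf.comp continuous_subtype_val) _) (f.subgroupMap_surjective M) h

-- In a finite quotient of MN the image of N is normal, and the quotient by it is an image of M;
-- both layers are in X.
open scoped Pointwise in
theorem sup (hX : IsGroupClass X) [TotallyDisconnectedSpace G] {M N : Subgroup G}
    (hM : IsProClass X M) (hN : IsProClass X N)
    (hMN : M ≤ Subgroup.normalizer (N : Set G)) : IsProClass X (M ⊔ N : Subgroup G) := by
  have hmul : ((M ⊔ N : Subgroup G) : Set G) = (M : Set G) * (N : Set G) :=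
    (Subgroup.coe_mul_of_left_le_normalizer_right M N hMN)
  have hcomp : IsCompact ((M ⊔ N : Subgroup G) : Set G) := by
    rw [hmul]
    exact hM.isCompact.mul hN.isCompact
  have hcs : CompactSpace (M ⊔ N : Subgroup G) := isCompact_iff_compactSpace.1 hcomp
  refine ⟨⟨hcs, inferInstance⟩, fun K hK hKo => ?_⟩
  let S : Subgroup G := M ⊔ N
  let iM : M →* S := Subgroup.inclusion le_sup_left
  let iN : N →* S := Subgroup.inclusion le_sup_right
  have hiM : Continuous iM := continuous_inclusion (le_sup_left : M ≤ S)
  have hiN : Continuous iN := continuous_inclusion (le_sup_right : N ≤ S)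
  have hnorm : ∀ s : S, ∀ n : N, ∃ n' : N, s * iN n * s⁻¹ = iN n' := by
    intro s n
    have hs : (s : G) ∈ Subgroup.normalizer (N : Set G) :=
      sup_le hMN Subgroup.le_normalizer s.2
    exact ⟨⟨s * n * (s : G)⁻¹, (Subgroup.mem_normalizer_iff.1 hs _).1 n.2⟩, Subtype.ext rfl⟩
  let g : N ⧸ K.comap iN →* S ⧸ K := QuotientGroup.map _ K iN le_rfl
  have hg : g.range.Normal := by
    refine ⟨?_⟩
    rintro _ ⟨y, rfl⟩ z
    obtain ⟨n, rfl⟩ := QuotientGroup.mk_surjective y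
    obtain ⟨s, rfl⟩ := QuotientGroup.mk_surjective z
    obtain ⟨n', hn'⟩ := hnorm s n
    refine ⟨QuotientGroup.mk n', ?_⟩
    change (QuotientGroup.mk (iN n') : S ⧸ K) = QuotientGroup.mk (s * iN n * s⁻¹)
    rw [hn']
  refine hX.of_ker_le_range g (QuotientGroup.mk' g.range) (by simp)
    (hN.2 _ (hKo.preimage hiN)) ?_
  refine hX.of_surjective
    ((QuotientGroup.mk' g.range).comp (QuotientGroup.map (K.comap iM) K iM le_rfl)) ?_
    (hM.2 _ (hKo.preimage hiM))
  intro y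
  obtain ⟨z, rfl⟩ := QuotientGroup.mk_surjective y
  obtain ⟨s, rfl⟩ := QuotientGroup.mk_surjective z
  have hs : (s : G) ∈ (M : Set G) * N := by rw [← hmul]; exact s.2
  obtain ⟨m, hm, n, hn, hmn⟩ := hs
  refine ⟨QuotientGroup.mk ⟨m, hm⟩, ?_⟩
  change (QuotientGroup.mk (QuotientGroup.mk (iM ⟨m, hm⟩) : S ⧸ K) : (S ⧸ K) ⧸ g.range) =
    QuotientGroup.mk (QuotientGroup.mk s)
  rw [QuotientGroup.eq]
  refine ⟨QuotientGroup.mk ⟨n, hn⟩, ?_⟩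
  change (QuotientGroup.mk (iN ⟨n, hn⟩) : S ⧸ K) = QuotientGroup.mk ((iM ⟨m, hm⟩)⁻¹ * s)
  congr 1
  apply Subtype.ext
  change n = m⁻¹ * (s : G)
  rw [← hmn]; simp

end

/-- A profinite group is pro-`X` as soon as its only closed normal subgroup without nontrivial
continuous quotient in `X` is the trivial one. -/
theorem of_perfect_eq_bot (hX : IsGroupClass X) {F : Type u} [Group F] [TopologicalSpace F]
    [IsTopologicalGroup F] [CompactSpace F] [TotallyDisconnectedSpace F]
    (h : ∀ R : Subgroup F, R.Normal → IsClosed (R : Set F) →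
      (∀ (A : Type u) [Group A] (f : R →* A), X A → IsOpen (f.ker : Set R) → ∀ r, f r = 1) →
      R = ⊥) : IsProClass X F := by
  let ι := {N : Subgroup F // ∃ _ : N.Normal, IsOpen (N : Set F) ∧ X (F ⧸ N)}
  have hιn : ∀ i : ι, i.1.Normal := fun i => i.2.1
  have hιc : ∀ i : ι, IsClosed (i.1 : Set F) := fun i => i.1.isClosed_of_isOpen i.2.2.1
  have hιX : ∀ i : ι, X (F ⧸ i.1) := fun i => i.2.2.2
  -- R is the X-residual of F. Open normal subgroups above R have quotients in X, so it suffices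
  -- that R is trivial; by hypothesis this follows once R has no nontrivial X-quotient.
  let R : Subgroup F := ⨅ i : ι, i.1
  have hRmem : ∀ x, x ∈ R ↔ ∀ i : ι, x ∈ i.1 := fun x => Subgroup.mem_iInf
  have hRn : R.Normal := Subgroup.normal_iInf_normal hιn
  have hRc : IsClosed (R : Set F) := by
    have : (R : Set F) = ⋂ i : ι, (i.1 : Set F) := Subgroup.coe_iInf
    rw [this]
    exact isClosed_iInter hιc
  have hRO : ∀ (O : Subgroup F) [O.Normal], IsOpen (O : Set F) → R ≤ O → X (F ⧸ O) :=
    fun O _ hO hle => hX.quotient_of_iInf_le (fun i : ι => i.1) hιn hιX hιc O hO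
      (fun x hx => hle ((hRmem x).2 hx))
  have hR : R = ⊥ := by
    refine h R hRn hRc fun A _ f hA hf => ?_
    have hRcs : CompactSpace R := isCompact_iff_compactSpace.1 hRc.isCompact
    let c : F → R →* R := fun v => ((MulAut.conjNormal v : MulAut R) : R →* R)
    have hcval : ∀ v r, ((c v r : R) : F) = v * r * v⁻¹ := fun v r => MulAut.conjNormal_apply v r
    have hcc : ∀ v, Continuous (c v) := by
      intro v
      rw [continuous_induced_rng]
      have : (Subtype.val ∘ (c v)) = fun r : R => v * (r : F) * v⁻¹ := funext (hcval v)
      rw [this]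
      fun_prop
    let K : F → Subgroup R := fun v => (f.comp (c v)).ker
    have hKo : ∀ v, IsOpen (K v : Set R) := fun v => hf.preimage (hcc v)
    have h1 : (f.ker : Set R) ∈ 𝓝 (1 : R) := hf.mem_nhds (Subgroup.one_mem _)
    rw [nhds_induced] at h1
    obtain ⟨V, hV, hVf⟩ := h1
    obtain ⟨M, hM, hMo, hMV⟩ := exists_open_normal_le hV
    -- The F-conjugates of the kernel of `f` meet in O. It contains M ∩ R, so it is open; by
    -- compactness R/O is then in X.
    let O : Subgroup R := ⨅ v, K v
    have hOmem : ∀ r : R, r ∈ O ↔ ∀ v, f (c v r) = 1 := fun r => Subgroup.mem_iInf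
    have hOn : O.Normal := Subgroup.normal_iInf_normal fun v => MonoidHom.normal_ker _
    have hMO : M.subgroupOf R ≤ O := by
      intro r hr
      rw [hOmem]
      intro v
      refine hVf (hMV ?_)
      rw [hcval]
      exact hM.conj_mem _ hr v
    have hOo : IsOpen (O : Set R) :=
      Subgroup.isOpen_mono hMO (hMo.preimage continuous_subtype_val)
    have hXO : X (R ⧸ O) := by
      refine hX.quotient_of_iInf_le K (fun v => MonoidHom.normal_ker _) (fun v => ?_)
        (fun v => (K v).isClosed_of_isOpen (hKo v)) O hOo (fun x hx => (hOmem x).2 hx)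
      exact hX.of_injective (QuotientGroup.kerLift _) (QuotientGroup.kerLift_injective _) hA
    let O' : Subgroup F := O.map R.subtype
    have hO'n : O'.Normal := by
      refine ⟨?_⟩
      rintro _ ⟨r, hr, rfl⟩ g
      refine ⟨c g r, ?_, hcval g r⟩
      change c g r ∈ O
      rw [hOmem]
      intro v
      have : c v (c g r) = c (v * g) r := by
        apply Subtype.ext
        rw [hcval, hcval, hcval]
        group
      rw [this]
      exact (hOmem r).1 hr _
    have hMop : IsOpen ((M ⊔ O' : Subgroup F) : Set F) := Subgroup.isOpen_mono le_sup_left hMo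
    have hMRop : IsOpen ((M ⊔ R : Subgroup F) : Set F) := Subgroup.isOpen_mono le_sup_left hMo
    have hle1 : M ⊔ O' ≤ M ⊔ R := sup_le_sup_left (Subgroup.map_subtype_le O) M
    -- F/MO' is an extension of an image of R/O by F/MR.
    have hXMO : X (F ⧸ (M ⊔ O')) := by
      refine hX.of_ker_le_range
        (QuotientGroup.map O (M ⊔ O') R.subtype
          (fun r hr => (le_sup_right : O' ≤ M ⊔ O') ⟨r, hr, rfl⟩))
        (QuotientGroup.map (M ⊔ O') (M ⊔ R) (MonoidHom.id F) hle1) ?_ hXO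
        (hRO (M ⊔ R) hMRop le_sup_right)
      intro y hy
      obtain ⟨x, rfl⟩ := QuotientGroup.mk_surjective y
      replace hy : x ∈ M ⊔ R := (QuotientGroup.eq_one_iff (N := M ⊔ R) x).1 hy
      rw [← SetLike.mem_coe, Subgroup.normal_mul] at hy
      obtain ⟨m, hm, r, hr, rfl⟩ := hy
      refine ⟨QuotientGroup.mk ⟨r, hr⟩, ?_⟩
      refine (QuotientGroup.eq (s := M ⊔ O')).2 ?_
      change r⁻¹ * (m * r) ∈ M ⊔ O'
      refine (le_sup_left : M ≤ M ⊔ O') ?_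
      have := hM.conj_mem m hm r⁻¹
      simpa [mul_assoc] using this
    -- So r = mo with o in O and m in M ∩ R, and `f` kills both factors.
    have hRle : R ≤ M ⊔ O' := fun x hx => (hRmem x).1 hx ⟨M ⊔ O', inferInstance, hMop, hXMO⟩
    intro r
    have hr := hRle r.2
    rw [← SetLike.mem_coe, Subgroup.normal_mul] at hr
    obtain ⟨m, hm, _, ⟨o, ho, rfl⟩, hmo⟩ := hr
    have hmR : m ∈ R := by
      have : m = (r : F) * (o : F)⁻¹ := by rw [← hmo]; simp
      rw [this]
      exact R.mul_mem r.2 (R.inv_mem o.2)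
    have h2 : r = ⟨m, hmR⟩ * o := Subtype.ext hmo.symm
    have h3 : f o = 1 := by
      have := (hOmem o).1 ho 1
      have h4 : c 1 o = o := Subtype.ext (by rw [hcval]; simp)
      rwa [h4] at this
    have h5 : f ⟨m, hmR⟩ = 1 := hVf (hMV hm)
    rw [h2, map_mul, h3, h5, one_mul]
  refine ⟨⟨inferInstance, inferInstance⟩, fun N _ hN => hRO N hN ?_⟩
  rw [hR]
  exact bot_le

end IsProClass

/-! ### Soluble groups and finite η-groups as classes -/

theorem isGroupClass_isSolvable : IsGroupClass.{u} (fun H _ => Group.IsSolvable H) where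
  of_subsingleton _ _ _ := inferInstance
  of_injective _ hf _ := Group.isSolvable_of_isSolvable_injective hf
  of_ker_le_range g f h _ _ := Group.isSolvable_of_ker_le_range g f h

theorem isGroupClass_primes (η : Set ℕ) :
    IsGroupClass.{u} (fun H _ => Finite H ∧ ∀ p : ℕ, p.Prime → p ∣ Nat.card H → p ∈ η) where
  of_subsingleton A _ _ :=
    ⟨inferInstance, fun p hp h => (hp.one_lt.ne' (by simpa using h)).elim⟩
  of_injective f hf h := by
    have := h.1
    exact ⟨Finite.of_injective f hf, fun p hp hd =>
      h.2 p hp (hd.trans (Subgroup.card_dvd_of_injective f hf))⟩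
  of_ker_le_range g f h hA hB := by
    have := hA.1
    have := hB.1
    have hr : Finite g.range := Finite.of_surjective _ g.rangeRestrict_surjective
    have hk : Finite f.ker := Finite.of_injective _ (Subgroup.inclusion_injective h)
    have hcard := Subgroup.index_mul_card f.ker
    rw [Subgroup.index_ker] at hcard
    refine ⟨(MonoidHom.finite_iff_finite_ker_range f).2 ⟨hk, inferInstance⟩, fun p hp hd => ?_⟩
    rw [← hcard] at hd
    rcases (hp.dvd_mul).1 hd with hd | hd
    · exact hB.2 p hp (hd.trans (Subgroup.card_subgroup_dvd_card _))
    · exact hA.2 p hp ((hd.trans (Subgroup.card_dvd_of_le h)).trans (Subgroup.card_range_dvd g))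

theorem isProClass_primes_iff {η : Set ℕ} {H : Type u} [Group H] [TopologicalSpace H]
    [IsTopologicalGroup H] :
    IsProClass (fun H _ => Finite H ∧ ∀ p : ℕ, p.Prime → p ∣ Nat.card H → p ∈ η) H ↔
      IsPro η H := by
  refine ⟨fun h => ⟨h.1, fun N hN hNo p hp hd => (h.2 N hNo).2 p hp hd⟩,
    fun h => ⟨h.1, fun N hN hNo => ⟨?_, fun p hp hd => h.2 N hN hNo p hp hd⟩⟩⟩
  have := h.1.1
  exact Subgroup.quotient_finite_of_isOpen N hNo

/-! ### Small compact open subgroups -/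

section Basics

variable {G : Type u} [Group G]

theorem Subgroup.le_normalizer_of_conj_mem {U M : Subgroup G}
    (h : ∀ u ∈ U, ∀ m ∈ M, u * m * u⁻¹ ∈ M) : U ≤ Subgroup.normalizer (M : Set G) := by
  intro u hu
  rw [Subgroup.mem_normalizer_iff]
  refine fun m => ⟨h u hu m, fun hm => ?_⟩
  have := h u⁻¹ (U.inv_mem hu) _ hm
  simpa [mul_assoc] using this

variable [TopologicalSpace G] [IsTopologicalGroup G]

-- Van Dantzig's theorem: a compact open neighbourhood W of 1 has an open stabiliser under right
-- translation, and this stabiliser lies in W because 1 does.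
open scoped Pointwise in
theorem exists_open_compact_subgroup [LocallyCompactSpace G] [TotallyDisconnectedSpace G]
    {V : Set G} (hV : V ∈ 𝓝 (1 : G)) :
    ∃ U : Subgroup G, IsOpen (U : Set G) ∧ IsCompact (U : Set G) ∧ (U : Set G) ⊆ V := by
  obtain ⟨K, ⟨hK, hKc⟩, hKV⟩ := (compact_basis_nhds (1 : G)).mem_iff.1 hV
  obtain ⟨W, hW, h1W, hWK⟩ :=
    (loc_compact_Haus_tot_disc_of_zero_dim (H := G)).mem_nhds_iff.1 hK
  have hWc : IsCompact W := hKc.of_isClosed_subset hW.1 hWK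
  have hN : ∀ᶠ g in 𝓝 (1 : G), ∀ w ∈ W, w * g ∈ W := by
    refine (hWc.eventually_forall_of_forall_eventually (P := fun g w => w * g ∈ W) ?_)
    intro w hw
    have hc : ContinuousAt (fun z : G × G => z.2 * z.1) (1, w) := by fun_prop
    exact hc (hW.2.mem_nhds (by simpa using hw))
  let U : Subgroup G :=
    { carrier := {g | ∀ w ∈ W, w * g ∈ W ∧ w * g⁻¹ ∈ W}
      one_mem' := fun w hw => by simpa using hw
      mul_mem' := fun {a b} ha hb w hw =>
        ⟨by simpa [mul_assoc] using (hb _ (ha w hw).1).1,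
          by simpa [mul_assoc] using (ha _ (hb w hw).2).2⟩
      inv_mem' := fun {a} ha w hw => ⟨(ha w hw).2, by simpa using (ha w hw).1⟩ }
  have hUo : IsOpen (U : Set G) := by
    refine U.isOpen_of_mem_nhds (g := 1) ?_
    have hinv : Filter.Tendsto (fun g : G => g⁻¹) (𝓝 1) (𝓝 1) := by
      simpa using (continuous_inv.tendsto (1 : G))
    filter_upwards [hN, hinv.eventually hN] with g hg hg' w hw
    exact ⟨hg w hw, hg' w hw⟩
  have hUW : (U : Set G) ⊆ W := fun g hg => by simpa using (hg 1 h1W).1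
  exact ⟨U, hUo, hWc.of_isClosed_subset (U.isClosed_of_isOpen hUo) hUW, hUW.trans (hWK.trans hKV)⟩

theorem exists_open_normalized_subgroup [TotallyDisconnectedSpace G] {U : Subgroup G}
    (hUo : IsOpen (U : Set G)) (hUc : IsCompact (U : Set G)) {V : Set G} (hV : V ∈ 𝓝 (1 : G)) :
    ∃ W : Subgroup G, W ≤ U ∧ IsOpen (W : Set G) ∧ (W : Set G) ⊆ V ∧
      ∀ u ∈ U, ∀ w ∈ W, u * w * u⁻¹ ∈ W := by
  have : CompactSpace U := isCompact_iff_compactSpace.1 hUc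
  have h1 : (Subtype.val ⁻¹' V : Set U) ∈ 𝓝 (1 : U) :=
    continuous_subtype_val.continuousAt.preimage_mem_nhds (by simpa using hV)
  obtain ⟨N, hN, hNo, hNV⟩ := exists_open_normal_le h1
  refine ⟨N.map U.subtype, Subgroup.map_subtype_le N, ?_, ?_, ?_⟩
  · exact hUo.isOpenMap_subtype_val _ hNo
  · rintro _ ⟨x, hx, rfl⟩
    exact hNV hx
  · rintro u hu _ ⟨x, hx, rfl⟩
    exact ⟨⟨u, hu⟩ * x * ⟨u, hu⟩⁻¹, hN.conj_mem x hx _, rfl⟩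

theorem IsCompact.subgroup_inf_open [TotallyDisconnectedSpace G] {L V : Subgroup G}
    (hL : IsCompact (L : Set G)) (hV : IsOpen (V : Set G)) :
    IsCompact ((L ⊓ V : Subgroup G) : Set G) :=
  hL.inter_right (V.isClosed_of_isOpen hV)

end Basics

/-! ### Consequences of topological simplicity -/

namespace InClassS

variable {G : Type u} [Group G] [TopologicalSpace G] [IsTopologicalGroup G]

/-- Otherwise G itself is profinite; an open normal subgroup missing some x ≠ 1 must be trivial,
which makes G discrete. -/
theorem eq_bot_of_isCompact_of_normal (hG : InClassS G) {N : Subgroup G} (hN : N.Normal)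
    (hNc : IsCompact (N : Set G)) : N = ⊥ := by
  have := hG.totallyDisconnected
  rcases hG.topologicallySimple.2 N hN hNc.isClosed with h | h
  · exact h
  exfalso
  have : CompactSpace G := ⟨by simpa [h] using hNc⟩
  obtain ⟨x, hx⟩ := @exists_ne G hG.topologicallySimple.1 1
  obtain ⟨M, hM, hMo, hMx⟩ := exists_open_normal_le (V := ({x}ᶜ : Set G))
    (isOpen_compl_singleton.mem_nhds (by simpa using hx.symm))
  rcases hG.topologicallySimple.2 M hM (M.isClosed_of_isOpen hMo) with h | h
  · refine hG.nonDiscrete (discreteTopology_of_isOpen_singleton_one ?_)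
    simpa [h] using hMo
  · exact hMx (by rw [h]; trivial : x ∈ (M : Set G)) rfl

/-- D is dense, so finitely many cosets dU with d in D cover a compact generating set. -/
theorem exists_finite_generating (hG : InClassS G) {D : Subgroup G} (hD : D.Normal)
    (hD1 : D ≠ ⊥) {U : Subgroup G} (hU : IsOpen (U : Set G)) :
    ∃ S : Set G, S.Finite ∧ S ⊆ D ∧ (∀ s ∈ S, s⁻¹ ∈ S) ∧
      Subgroup.closure (S ∪ (U : Set G)) = ⊤ := by
  have hdense : D.topologicalClosure = ⊤ := by
    rcases hG.topologicallySimple.2 D.topologicalClosure (Subgroup.is_normal_topologicalClosure D)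
      D.isClosed_topologicalClosure with h | h
    · exact (hD1 (le_bot_iff.1 (h ▸ D.le_topologicalClosure))).elim
    · exact h
  obtain ⟨K, hK, hKtop⟩ := hG.compactlyGenerated
  obtain ⟨t, ht⟩ := hK.elim_finite_subcover (fun d : D => {x : G | (d : G)⁻¹ * x ∈ U})
    (fun d => hU.preimage (continuous_const.mul continuous_id)) (by
      intro x _
      have hx : x ∈ closure (D : Set G) := by
        have : x ∈ D.topologicalClosure := by rw [hdense]; trivial
        exact this
      have hop : IsOpen {y : G | y⁻¹ * x ∈ U} :=
        hU.preimage (continuous_inv.mul continuous_const)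
      obtain ⟨d, hd, hdD⟩ := mem_closure_iff.1 hx _ hop (by simp)
      exact Set.mem_iUnion.2 ⟨⟨d, hdD⟩, hd⟩)
  let T : Set G := (fun d : D => (d : G)) '' (t : Set D)
  have hT : T.Finite := t.finite_toSet.image _
  have hTD : T ⊆ D := by rintro _ ⟨d, _, rfl⟩; exact d.2
  refine ⟨T ∪ T⁻¹, hT.union hT.inv, Set.union_subset hTD fun x hx => ?_, ?_, ?_⟩
  · exact inv_mem_iff.1 (hTD hx)
  · rintro s (hs | hs)
    · exact Or.inr (by simpa using hs)
    · exact Or.inl hs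
  · rw [eq_top_iff, ← hKtop, Subgroup.closure_le]
    intro x hx
    obtain ⟨d, hd, hdx⟩ := Set.mem_iUnion₂.1 (ht hx)
    have h1 : (d : G) ∈ Subgroup.closure (T ∪ T⁻¹ ∪ (U : Set G)) :=
      Subgroup.subset_closure (Or.inl (Or.inl ⟨d, hd, rfl⟩))
    have h2 : (d : G)⁻¹ * x ∈ Subgroup.closure (T ∪ T⁻¹ ∪ (U : Set G)) :=
      Subgroup.subset_closure (Or.inr hdx)
    simpa using Subgroup.mul_mem _ h1 h2

/-- If some nontrivial normal subgroup consists of elements each of which centralises a relatively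
open subgroup of `M`, then `M` is discrete. -/
theorem exists_inf_eq_bot_of_centralising (hG : InClassS G) {U M : Subgroup G}
    (hUo : IsOpen (U : Set G)) (hUc : IsCompact (U : Set G)) (hM : IsCompact (M : Set G))
    (hUM : ∀ u ∈ U, ∀ m ∈ M, u * m * u⁻¹ ∈ M) {D : Subgroup G} (hD : D.Normal) (hD1 : D ≠ ⊥)
    (hc : ∀ d ∈ D, ∀ᶠ x in 𝓝 (1 : G), x ∈ M → d * x = x * d) :
    ∃ V : Subgroup G, IsOpen (V : Set G) ∧ M ⊓ V = ⊥ := by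
  have := hG.totallyDisconnected
  obtain ⟨S, hSf, hSD, -, hS⟩ := hG.exists_finite_generating hD hD1 hUo
  have hev : ∀ᶠ x in 𝓝 (1 : G), ∀ s ∈ S, x ∈ M → s * x = x * s :=
    (Filter.eventually_all_finite hSf).2 fun s hs => hc s (hSD hs)
  obtain ⟨W, -, hWo, hWV, hUW⟩ := exists_open_normalized_subgroup hUo hUc hev
  -- S centralises M ∩ W and U normalises it, so it is a compact normal subgroup of G.
  refine ⟨W, hWo, hG.eq_bot_of_isCompact_of_normal ?_ (hM.subgroup_inf_open hWo)⟩
  rw [← Subgroup.normalizer_eq_top_iff, eq_top_iff, ← hS, Subgroup.closure_le]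
  rintro g (hg | hg)
  · refine Subgroup.mem_normalizer_iff.2 fun x => ?_
    constructor
    · intro hx
      have : g * x * g⁻¹ = x := by rw [hWV hx.2 g hg hx.1]; simp
      rwa [this]
    · intro hx
      have h1 := hWV hx.2 g hg hx.1
      have : x = g * x * g⁻¹ := by
        have := congrArg (fun y => g⁻¹ * y) h1
        simpa [mul_assoc] using this.symm
      rwa [this]
  · exact Subgroup.le_normalizer_of_conj_mem (U := U) (M := M ⊓ W)
      (fun u hu m hm => ⟨hUM u hu m hm.1, hUW u hu m hm.2⟩) hg

/-- The quasi-centre of a group in the class `𝒮` is trivial. -/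
theorem eq_one_of_eventually_commute (hG : InClassS G) {x : G}
    (hx : ∀ᶠ g in 𝓝 (1 : G), g * x = x * g) : x = 1 := by
  have := hG.totallyDisconnected
  have := hG.locallyCompact
  let D : Subgroup G :=
    { carrier := {x | ∀ᶠ g in 𝓝 (1 : G), x * g = g * x}
      one_mem' := by simp
      mul_mem' := by
        intro a b ha hb
        filter_upwards [ha, hb] with g h1 h2
        rw [mul_assoc, h2, ← mul_assoc, h1, mul_assoc]
      inv_mem' := by
        intro a ha
        filter_upwards [ha] with g h1
        rw [inv_mul_eq_iff_eq_mul, ← mul_assoc, h1]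
        simp }
  have hD : D.Normal := by
    refine ⟨fun n hn g => ?_⟩
    have ht : Filter.Tendsto (fun y : G => g⁻¹ * y * g) (𝓝 1) (𝓝 1) := by
      have : Continuous (fun y : G => g⁻¹ * y * g) := by fun_prop
      simpa using this.tendsto 1
    filter_upwards [ht.eventually hn] with y hy
    have := congrArg (fun z => g * z * g⁻¹) hy
    simpa [mul_assoc] using this
  by_contra hx1
  have hD1 : D ≠ ⊥ := fun h => hx1 (by
    have : x ∈ D := by filter_upwards [hx] with g hg using hg.symm
    rw [h] at this
    exact this)
  obtain ⟨U, hUo, hUc, -⟩ := exists_open_compact_subgroup (G := G) Filter.univ_mem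
  obtain ⟨V, hVo, hV⟩ := hG.exists_inf_eq_bot_of_centralising hUo hUc hUc
    (fun u hu m hm => U.mul_mem (U.mul_mem hu hm) (U.inv_mem hu)) hD hD1
    (fun d hd => by filter_upwards [hd] with g hg _ using hg)
  refine hG.nonDiscrete (discreteTopology_of_isOpen_singleton_one ?_)
  have : ((U ⊓ V : Subgroup G) : Set G) = {1} := by rw [hV]; rfl
  rw [← this]
  exact hUo.inter hVo

/-- A subgroup with open normaliser that meets an open subgroup trivially is trivial. -/
theorem eq_bot_of_inf_eq_bot (hG : InClassS G) {L : Subgroup G}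
    (hL : ∀ᶠ g in 𝓝 (1 : G), ∀ l ∈ L, g * l * g⁻¹ ∈ L) {V : Set G} (hV : V ∈ 𝓝 (1 : G))
    (h : ∀ l ∈ L, l ∈ V → l = 1) : L = ⊥ := by
  rw [eq_bot_iff]
  intro l hl
  refine hG.eq_one_of_eventually_commute ?_
  -- For y near 1 the commutator of y and l lies in L and in V, hence is trivial; so l is
  -- quasi-central.
  have ht : Filter.Tendsto (fun y : G => y * l * y⁻¹ * l⁻¹) (𝓝 1) (𝓝 1) := by
    have : Continuous (fun y : G => y * l * y⁻¹ * l⁻¹) := by fun_prop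
    simpa using this.tendsto 1
  filter_upwards [hL, ht hV] with g h1 h2
  have := h _ (L.mul_mem (h1 l hl) (L.inv_mem hl)) h2
  rw [mul_inv_eq_one, mul_inv_eq_iff_eq_mul] at this
  exact this

end InClassS

/-! ### Conjugates of a subgroup and the commensurated subgroup they generate -/

section Conjugates

variable {G : Type u} [Group G]

/-- The conjugate `g A g⁻¹` of a subgroup. -/
def Subgroup.conjBy (g : G) (A : Subgroup G) : Subgroup G := A.map (MulAut.conj g).toMonoidHom

theorem Subgroup.mem_conjBy {g x : G} {A : Subgroup G} : x ∈ A.conjBy g ↔ g⁻¹ * x * g ∈ A := by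
  constructor
  · rintro ⟨a, ha, rfl⟩
    have : g⁻¹ * (g * a * g⁻¹) * g = a := by group
    simpa [this] using ha
  · intro h
    exact ⟨_, h, by simp [mul_assoc]⟩

theorem Subgroup.conjBy_congr {U A : Subgroup G} (hUA : ∀ u ∈ U, ∀ a ∈ A, u * a * u⁻¹ ∈ A)
    {g h : G} (hgh : g⁻¹ * h ∈ U) : A.conjBy g = A.conjBy h := by
  ext x
  rw [mem_conjBy, mem_conjBy]
  constructor
  · intro hx
    have := hUA _ (U.inv_mem hgh) _ hx
    have e : (g⁻¹ * h)⁻¹ * (g⁻¹ * x * g) * (g⁻¹ * h)⁻¹⁻¹ = h⁻¹ * x * h := by group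
    rwa [e] at this
  · intro hx
    have := hUA _ hgh _ hx
    have e : (g⁻¹ * h) * (h⁻¹ * x * h) * (g⁻¹ * h)⁻¹ = g⁻¹ * x * g := by group
    rwa [e] at this

theorem Subgroup.exists_finset_of_mem_normalClosure {A : Subgroup G} {x : G}
    (hx : x ∈ Subgroup.normalClosure (A : Set G)) :
    ∃ F : Finset G, x ∈ ⨆ g ∈ F, A.conjBy g := by
  classical
  have hmono : ∀ {F F' : Finset G}, F ⊆ F' → ⨆ g ∈ F, A.conjBy g ≤ ⨆ g ∈ F', A.conjBy g :=
    fun h => biSup_mono fun g hg => h hg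
  induction hx using Subgroup.closure_induction with
  | mem y hy =>
    obtain ⟨a, ha, hay⟩ := Group.mem_conjugatesOfSet_iff.1 hy
    obtain ⟨g, rfl⟩ := isConj_iff.1 hay
    refine ⟨{g}, ?_⟩
    simp only [Finset.mem_singleton, iSup_iSup_eq_left]
    exact ⟨a, ha, rfl⟩
  | one => exact ⟨∅, Subgroup.one_mem _⟩
  | mul a b _ _ iha ihb =>
    obtain ⟨F, hF⟩ := iha
    obtain ⟨F', hF'⟩ := ihb
    exact ⟨F ∪ F', Subgroup.mul_mem _ (hmono Finset.subset_union_left hF)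
      (hmono Finset.subset_union_right hF')⟩
  | inv a _ iha =>
    obtain ⟨F, hF⟩ := iha
    exact ⟨F, Subgroup.inv_mem _ hF⟩

theorem conj_mem_iSup_inf {𝒜 : Set (Subgroup G)} {U W : Subgroup G}
    (hU𝒜 : ∀ u ∈ U, ∀ B ∈ 𝒜, B.conjBy u ∈ 𝒜)
    (hUW : ∀ u ∈ U, ∀ w ∈ W, u * w * u⁻¹ ∈ W) :
    ∀ u ∈ U, ∀ m ∈ ⨆ B ∈ 𝒜, B ⊓ W, u * m * u⁻¹ ∈ ⨆ B ∈ 𝒜, B ⊓ W := by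
  intro u hu
  have : ⨆ B ∈ 𝒜, B ⊓ W ≤ (⨆ B ∈ 𝒜, B ⊓ W).comap (MulAut.conj u).toMonoidHom := by
    refine iSup₂_le fun B hB b hb => ?_
    refine (le_iSup₂_of_le (f := fun (B : Subgroup G) (_ : B ∈ 𝒜) => B ⊓ W)
      (B.conjBy u) (hU𝒜 u hu B hB) le_rfl) ?_
    exact ⟨⟨b, hb.1, rfl⟩, hUW u hu b hb.2⟩
  exact fun m hm => this hm

variable [TopologicalSpace G]

/-- A subgroup that is commensurate with all its conjugates, in the sense that conjugation maps
its elements close to the identity into it. -/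
def IsLocallyCommensurated (M : Subgroup G) : Prop :=
  ∀ g : G, ∀ᶠ x in 𝓝 (1 : G), x ∈ M → g * x * g⁻¹ ∈ M

variable [IsTopologicalGroup G]

theorem tendsto_conj_one (g : G) : Filter.Tendsto (fun x : G => g * x * g⁻¹) (𝓝 1) (𝓝 1) := by
  have : Continuous (fun x : G => g * x * g⁻¹) := by fun_prop
  simpa using this.tendsto 1

theorem tendsto_inv_mul_conj_one (g : G) :
    Filter.Tendsto (fun x : G => g⁻¹ * x * g * x⁻¹) (𝓝 1) (𝓝 1) := by
  have : Continuous (fun x : G => g⁻¹ * x * g * x⁻¹) := by fun_prop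
  simpa using this.tendsto 1

theorem IsLocallyCommensurated.of_generates {M : Subgroup G} {S : Set G}
    (hS : Subgroup.closure S = ⊤) (h : ∀ s ∈ S, ∀ᶠ x in 𝓝 (1 : G), x ∈ M → s * x * s⁻¹ ∈ M)
    (h' : ∀ s ∈ S, ∀ᶠ x in 𝓝 (1 : G), x ∈ M → s⁻¹ * x * s⁻¹⁻¹ ∈ M) :
    IsLocallyCommensurated M := by
  have hmul : ∀ a b : G, (∀ᶠ x in 𝓝 (1 : G), x ∈ M → a * x * a⁻¹ ∈ M) →
      (∀ᶠ x in 𝓝 (1 : G), x ∈ M → b * x * b⁻¹ ∈ M) →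
      ∀ᶠ x in 𝓝 (1 : G), x ∈ M → (a * b) * x * (a * b)⁻¹ ∈ M := by
    intro a b ha hb
    filter_upwards [hb, (tendsto_conj_one b).eventually ha] with x h1 h2 hx
    have := h2 (h1 hx)
    simpa [mul_assoc] using this
  let C : Subgroup G :=
    { carrier := {g | (∀ᶠ x in 𝓝 (1 : G), x ∈ M → g * x * g⁻¹ ∈ M) ∧
        ∀ᶠ x in 𝓝 (1 : G), x ∈ M → g⁻¹ * x * g⁻¹⁻¹ ∈ M}
      one_mem' := by simp
      mul_mem' := fun {a b} ha hb => ⟨hmul a b ha.1 hb.1, by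
        rw [mul_inv_rev]
        exact hmul _ _ hb.2 ha.2⟩
      inv_mem' := fun {a} ha => ⟨ha.2, by simpa only [inv_inv] using ha.1⟩ }
  have hC : C = ⊤ := by
    rw [eq_top_iff, ← hS, Subgroup.closure_le]
    exact fun s hs => ⟨h s hs, h' s hs⟩
  intro g
  have : g ∈ C := by rw [hC]; trivial
  exact this.1

namespace InClassS

/-- A finite family of conjugates of `A`, invariant under `U`, that together with `U` generates
`G`, and an open subgroup of `U` normalising each of them. -/
theorem exists_finite_conjugates (hG : InClassS G) {U A : Subgroup G} (hUo : IsOpen (U : Set G))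
    (hUc : IsCompact (U : Set G)) (hA1 : A ≠ ⊥) (hUA : ∀ u ∈ U, ∀ a ∈ A, u * a * u⁻¹ ∈ A) :
    ∃ (𝒜 : Set (Subgroup G)) (W : Subgroup G), 𝒜.Finite ∧ A ∈ 𝒜 ∧
      (∀ B ∈ 𝒜, ∃ g, B = A.conjBy g) ∧ (∀ u ∈ U, ∀ B ∈ 𝒜, B.conjBy u ∈ 𝒜) ∧
      Subgroup.closure ((⋃ B ∈ 𝒜, (B : Set G)) ∪ U) = ⊤ ∧
      W ≤ U ∧ IsOpen (W : Set G) ∧ (∀ u ∈ U, ∀ w ∈ W, u * w * u⁻¹ ∈ W) ∧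
      ∀ B ∈ 𝒜, ∀ w ∈ W, ∀ b ∈ B, w * b * w⁻¹ ∈ B := by
  classical
  have := hG.totallyDisconnected
  have hUcs : CompactSpace U := isCompact_iff_compactSpace.1 hUc
  have hD1 : Subgroup.normalClosure (A : Set G) ≠ ⊥ := fun h =>
    hA1 (le_bot_iff.1 (h ▸ Subgroup.le_normalClosure))
  obtain ⟨S, hSf, hSD, -, hS⟩ := hG.exists_finite_generating Subgroup.normalClosure_normal hD1 hUo
  choose! F hF using fun s (hs : s ∈ S) => Subgroup.exists_finset_of_mem_normalClosure (hSD hs)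
  -- Including 1 ensures that A itself belongs to the family.
  let T : Set G := insert 1 (⋃ s ∈ S, (F s : Set G))
  have hT : T.Finite := (hSf.biUnion fun s _ => (F s).finite_toSet).insert 1
  let 𝒜 : Set (Subgroup G) := ⋃ g ∈ T, Set.range fun u : U => A.conjBy (u * g)
  have hmem : ∀ g ∈ T, ∀ u ∈ U, A.conjBy (u * g) ∈ 𝒜 := fun g hg u hu =>
    Set.mem_biUnion hg ⟨⟨u, hu⟩, rfl⟩
  have hmem1 : ∀ g ∈ T, A.conjBy g ∈ 𝒜 := fun g hg => by
    simpa using hmem g hg 1 U.one_mem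
  have hex : ∀ B ∈ 𝒜, ∃ g ∈ T, ∃ u ∈ U, B = A.conjBy (u * g) := by
    intro B hB
    obtain ⟨g, hg, u, rfl⟩ := Set.mem_iUnion₂.1 hB
    exact ⟨g, hg, u, u.2, rfl⟩
  -- As U normalises A, the conjugate of A by ug is locally constant in u, and U is compact.
  have h𝒜 : 𝒜.Finite := by
    refine hT.biUnion fun g _ => IsLocallyConstant.range_finite ?_
    rw [IsLocallyConstant.iff_eventually_eq]
    intro x
    have hc : Continuous fun y : U => ((y : G) * g)⁻¹ * (x * g) := by fun_prop
    have : ∀ᶠ y : U in 𝓝 x, ((y : G) * g)⁻¹ * (x * g) ∈ (U : Set G) :=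
      hc.continuousAt (hUo.mem_nhds (by simp))
    filter_upwards [this] with y hy
    exact Subgroup.conjBy_congr hUA hy
  have hconj : ∀ (a b : G), (A.conjBy b).conjBy a = A.conjBy (a * b) := by
    intro a b
    ext x
    simp only [Subgroup.mem_conjBy, mul_inv_rev, mul_assoc]
  have hev : ∀ᶠ w in 𝓝 (1 : G), ∀ B ∈ 𝒜, ∀ b ∈ B, w * b * w⁻¹ ∈ B := by
    refine (Filter.eventually_all_finite h𝒜).2 fun B hB => ?_
    obtain ⟨g, hg, u, hu, rfl⟩ := hex B hB
    -- Near 1, conjugation by (ug)⁻¹ carries w into U, which normalises A.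
    filter_upwards [tendsto_conj_one (u * g)⁻¹ (hUo.mem_nhds U.one_mem)] with w hw b hb
    rw [Subgroup.mem_conjBy] at hb ⊢
    have := hUA _ hw _ hb
    have e : (u * g)⁻¹ * w * (u * g)⁻¹⁻¹ * ((u * g)⁻¹ * b * (u * g)) *
      ((u * g)⁻¹ * w * (u * g)⁻¹⁻¹)⁻¹ = (u * g)⁻¹ * (w * b * w⁻¹) * (u * g) := by group
    rwa [e] at this
  obtain ⟨W, hWU, hWo, hWV, hUW⟩ := exists_open_normalized_subgroup hUo hUc hev
  refine ⟨𝒜, W, h𝒜, ?_, ?_, ?_, ?_, hWU, hWo, hUW, fun B hB w hw => hWV hw B hB⟩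
  · have h1 := hmem1 1 (Set.mem_insert _ _)
    have : A.conjBy 1 = A := by ext x; simp [Subgroup.mem_conjBy]
    rwa [this] at h1
  · intro B hB
    obtain ⟨g, _, u, _, rfl⟩ := hex B hB
    exact ⟨_, rfl⟩
  · intro u hu B hB
    obtain ⟨g, hg, v, hv, rfl⟩ := hex B hB
    rw [hconj, ← mul_assoc]
    exact hmem g hg _ (U.mul_mem hu hv)
  · rw [eq_top_iff, ← hS, Subgroup.closure_le]
    rintro s (hs | hs)
    · have hle : ⨆ g ∈ F s, A.conjBy g ≤
          Subgroup.closure ((⋃ B ∈ 𝒜, (B : Set G)) ∪ U) := by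
        refine iSup₂_le fun g hg x hx => Subgroup.subset_closure (Or.inl ?_)
        exact Set.mem_biUnion (hmem1 g (Set.mem_insert_of_mem _ (Set.mem_biUnion hs hg))) hx
      exact hle (hF s hs)
    · exact Subgroup.subset_closure (Or.inr hs)

end InClassS

section Hull

variable {𝒜 : Set (Subgroup G)} {U W : Subgroup G}

/-- For a in B and x in the join near 1, the commutator axa⁻¹x⁻¹ is small, hence in W, and is in B
because W normalises B. So axa⁻¹ stays in the join. The members of the family together with U
generate G. -/
theorem isLocallyCommensurated_iSup_inf
    (hU𝒜 : ∀ u ∈ U, ∀ B ∈ 𝒜, B.conjBy u ∈ 𝒜)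
    (hgen : Subgroup.closure ((⋃ B ∈ 𝒜, (B : Set G)) ∪ U) = ⊤) (hWo : IsOpen (W : Set G))
    (hUW : ∀ u ∈ U, ∀ w ∈ W, u * w * u⁻¹ ∈ W)
    (hW𝒜 : ∀ B ∈ 𝒜, ∀ w ∈ W, ∀ b ∈ B, w * b * w⁻¹ ∈ B) :
    IsLocallyCommensurated (⨆ B ∈ 𝒜, B ⊓ W) := by
  have hM : ⨆ B ∈ 𝒜, B ⊓ W ≤ W := iSup₂_le fun B _ => inf_le_right
  have hB : ∀ B ∈ 𝒜, ∀ a ∈ B, ∀ᶠ x in 𝓝 (1 : G), x ∈ ⨆ B ∈ 𝒜, B ⊓ W →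
      a * x * a⁻¹ ∈ ⨆ B ∈ 𝒜, B ⊓ W := by
    intro B hB a ha
    have ht : Filter.Tendsto (fun x : G => a * x * a⁻¹ * x⁻¹) (𝓝 1) (𝓝 1) := by
      simpa using tendsto_inv_mul_conj_one a⁻¹
    filter_upwards [ht (hWo.mem_nhds W.one_mem)] with x hxW hx
    have h1 : a * x * a⁻¹ * x⁻¹ ∈ B ⊓ W := by
      refine ⟨?_, hxW⟩
      have := B.mul_mem ha (hW𝒜 B hB x (hM hx) _ (B.inv_mem ha))
      simpa [mul_assoc] using this
    have h2 : a * x * a⁻¹ * x⁻¹ ∈ ⨆ B ∈ 𝒜, B ⊓ W :=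
      (le_iSup₂_of_le (f := fun (B : Subgroup G) (_ : B ∈ 𝒜) => B ⊓ W) B hB le_rfl) h1
    simpa using Subgroup.mul_mem _ h2 hx
  refine IsLocallyCommensurated.of_generates hgen ?_ ?_
  · rintro s (hs | hs)
    · obtain ⟨B, hB', hsB⟩ := Set.mem_iUnion₂.1 hs
      exact hB B hB' s hsB
    · exact Filter.Eventually.of_forall (conj_mem_iSup_inf hU𝒜 hUW s hs)
  · rintro s (hs | hs)
    · obtain ⟨B, hB', hsB⟩ := Set.mem_iUnion₂.1 hs
      exact hB B hB' s⁻¹ (B.inv_mem hsB)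
    · exact Filter.Eventually.of_forall (conj_mem_iSup_inf hU𝒜 hUW s⁻¹ (U.inv_mem hs))

theorem isProClass_iSup_inf [TotallyDisconnectedSpace G] {X : ∀ (H : Type u) [Group H], Prop}
    (hX : IsGroupClass X)
    (h𝒜 : 𝒜.Finite) (hWo : IsOpen (W : Set G))
    (hW𝒜 : ∀ B ∈ 𝒜, ∀ w ∈ W, ∀ b ∈ B, w * b * w⁻¹ ∈ B) (h𝒜X : ∀ B ∈ 𝒜, IsProClass X B) :
    IsProClass X (⨆ B ∈ 𝒜, B ⊓ W : Subgroup G) := by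
  have hnorm : ∀ B ∈ 𝒜, W ≤ Subgroup.normalizer ((B ⊓ W : Subgroup G) : Set G) := fun B hB =>
    Subgroup.le_normalizer_of_conj_mem fun w hw b hb =>
      Subgroup.mem_inf.2 ⟨hW𝒜 B hB w hw b hb.1, W.mul_mem (W.mul_mem hw hb.2) (W.inv_mem hw)⟩
  have hpro : ∀ B ∈ 𝒜, IsProClass X (B ⊓ W : Subgroup G) := fun B hB =>
    (h𝒜X B hB).mono hX inf_le_left ((h𝒜X B hB).isCompact.subgroup_inf_open hWo)
  clear hW𝒜 h𝒜X
  induction 𝒜, h𝒜 using Set.Finite.induction_on with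
  | empty =>
    have : (⨆ B ∈ (∅ : Set (Subgroup G)), B ⊓ W) = ⊥ := by simp
    rw [this]
    refine ⟨⟨inferInstance, inferInstance⟩, fun N _ _ => ?_⟩
    have : Subsingleton ((⊥ : Subgroup G) ⧸ N) := Quotient.instSubsingletonQuotient _
    exact hX.of_subsingleton _
  | @insert B 𝒜 _ _ ih =>
    rw [iSup_insert]
    refine (hpro B (Set.mem_insert _ _)).sup hX (ih
      (fun B hB => hnorm B (Set.mem_insert_of_mem _ hB))
      fun B hB => hpro B (Set.mem_insert_of_mem _ hB)) ?_
    refine inf_le_right.trans (Subgroup.le_normalizer_of_conj_mem fun w hw => ?_)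
    have : ⨆ B ∈ 𝒜, B ⊓ W ≤ (⨆ B ∈ 𝒜, B ⊓ W).comap (MulAut.conj w).toMonoidHom := by
      refine iSup₂_le fun B hB b hb => ?_
      refine (le_iSup₂_of_le (f := fun (B : Subgroup G) (_ : B ∈ 𝒜) => B ⊓ W) B hB le_rfl) ?_
      exact (Subgroup.mem_normalizer_iff.1 (hnorm B (Set.mem_insert_of_mem _ hB) hw) b).1 hb
    exact fun m hm => this hm

end Hull

end Conjugates

/-! ### A commensurated compact subgroup controls an open subgroup -/

section Commensurated

variable {G : Type u} [Group G] [TopologicalSpace G] [IsTopologicalGroup G]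

/-- Elements whose commutators with elements close to the identity lie in `K`. -/
def IsLocallyCommensurated.centralizing {K : Subgroup G} (hK : IsLocallyCommensurated K) :
    Subgroup G where
  carrier := {h | ∀ᶠ u in 𝓝 (1 : G), h⁻¹ * u * h * u⁻¹ ∈ K}
  one_mem' := by simp
  mul_mem' := by
    intro a b ha hb
    filter_upwards [ha, hb, (tendsto_inv_mul_conj_one a).eventually (hK b⁻¹)] with u h1 h2 h3
    have := K.mul_mem (h3 h1) h2
    have e : b⁻¹ * (a⁻¹ * u * a * u⁻¹) * b⁻¹⁻¹ * (b⁻¹ * u * b * u⁻¹) =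
      (a * b)⁻¹ * u * (a * b) * u⁻¹ := by group
    rwa [e] at this
  inv_mem' := by
    intro a ha
    have ht : Filter.Tendsto (fun u : G => (a⁻¹ * u * a * u⁻¹)⁻¹) (𝓝 1) (𝓝 1) := by
      simpa using (tendsto_inv_mul_conj_one a).inv
    filter_upwards [ha, ht.eventually (hK a)] with u h1 h2
    have := h2 (K.inv_mem h1)
    have e : a * (a⁻¹ * u * a * u⁻¹)⁻¹ * a⁻¹ = a⁻¹⁻¹ * u * a⁻¹ * u⁻¹ := by group
    rwa [e] at this

theorem IsLocallyCommensurated.centralizing_normal {K : Subgroup G}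
    (hK : IsLocallyCommensurated K) : hK.centralizing.Normal := by
  refine ⟨fun h hh g => ?_⟩
  have h0 := tendsto_conj_one g⁻¹
  filter_upwards [h0.eventually hh,
    ((tendsto_inv_mul_conj_one h).comp h0).eventually (hK g)] with u h1 h2
  have := h2 h1
  simp only [Function.comp_apply] at this
  have e : g * (h⁻¹ * (g⁻¹ * u * g⁻¹⁻¹) * h * (g⁻¹ * u * g⁻¹⁻¹)⁻¹) * g⁻¹ =
    (g * h * g⁻¹)⁻¹ * u * (g * h * g⁻¹) * u⁻¹ := by group
  rwa [e] at this

theorem exists_finite_cosets [TotallyDisconnectedSpace G] {U K : Subgroup G}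
    (hUc : IsCompact (U : Set G)) (hKc : IsCompact (K : Set G))
    (hUK : ∀ u ∈ U, ∀ m ∈ K, u * m * u⁻¹ ∈ K) (hK : IsLocallyCommensurated K) {S : Set G}
    (hS : S.Finite) (hSK : S ⊆ hK.centralizing) {Ω : Set G}
    (hΩ : ∀ x ∈ Ω, ∃ k ∈ K, ∃ u ∈ U, ∃ s ∈ S, ∃ k' ∈ K, x = k * (u * s * u⁻¹) * k') :
    ∃ T ⊆ Ω, T.Finite ∧ ∀ x ∈ Ω, ∃ t ∈ T, ∃ k ∈ K, x = t * k := by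
  have : CompactSpace U := isCompact_iff_compactSpace.1 hUc
  have : CompactSpace K := isCompact_iff_compactSpace.1 hKc
  have hfin : ((QuotientGroup.mk : G → G ⧸ K) '' Ω).Finite := by
    have hsub : (QuotientGroup.mk : G → G ⧸ K) '' Ω ⊆
        ⋃ s ∈ S, Set.range fun z : K × U => (QuotientGroup.mk
          ((z.1 : G) * ((z.2 : G) * s * (z.2 : G)⁻¹)) : G ⧸ K) := by
      rintro _ ⟨x, hx, rfl⟩
      obtain ⟨k, hk, u, hu, s, hs, k', hk', rfl⟩ := hΩ x hx
      refine Set.mem_biUnion hs ⟨(⟨k, hk⟩, ⟨u, hu⟩), ?_⟩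
      rw [QuotientGroup.eq]
      simpa [mul_assoc] using hk'
    -- The coset of k(usu⁻¹) is locally constant in (k, u): commensuration absorbs a small change of
    -- k, and s lying in the centralizing subgroup absorbs one of u.
    refine (hS.biUnion fun s hs => IsLocallyConstant.range_finite ?_).subset hsub
    rw [IsLocallyConstant.iff_eventually_eq]
    rintro ⟨k₀, u₀⟩
    have c1 : Filter.Tendsto (fun z : K × U => (k₀ : G)⁻¹ * (z.1 : G)) (𝓝 (k₀, u₀)) (𝓝 1) := by
      have : Continuous fun z : K × U => (k₀ : G)⁻¹ * (z.1 : G) := by fun_prop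
      simpa using this.tendsto (k₀, u₀)
    have c2 : Filter.Tendsto (fun z : K × U => (u₀ : G)⁻¹ * (z.2 : G)) (𝓝 (k₀, u₀)) (𝓝 1) := by
      have : Continuous fun z : K × U => (u₀ : G)⁻¹ * (z.2 : G) := by fun_prop
      simpa using this.tendsto (k₀, u₀)
    filter_upwards [c1.eventually (hK (u₀ * s * (u₀ : G)⁻¹)⁻¹), c2.eventually (hSK hs)]
    rintro ⟨k, v⟩ h1 h2
    refine (QuotientGroup.eq.2 ?_).symm
    have h3 := K.mul_mem (h1 (K.mul_mem (K.inv_mem k₀.2) k.2)) (hUK u₀ u₀.2 _ h2)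
    refine (congrArg (· ∈ K) ?_).mp h3
    simp only
    group
  obtain ⟨T, hTΩ, hT⟩ := (Set.surjOn_image (QuotientGroup.mk : G → G ⧸ K) Ω).exists_bijOn_subset
  refine ⟨T, hTΩ, (hT.finite_iff_finite).2 hfin, fun x hx => ?_⟩
  obtain ⟨t, ht, htx⟩ := hT.surjOn ⟨x, hx, rfl⟩
  exact ⟨t, ht, t⁻¹ * x, QuotientGroup.eq.1 htx, by simp⟩

/-- Let `K` be a nontrivial compact commensurated subgroup of a group in the class `𝒮`,
normalised by a compact open subgroup `U`. Then `U` has an open subgroup whose finite continuous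
quotients are built from a single finite quotient of `K`. -/
theorem InClassS.exists_open_isProClass (hG : InClassS G) {U K : Subgroup G}
    (hUo : IsOpen (U : Set G)) (hUc : IsCompact (U : Set G)) (hKU : K ≤ U)
    (hKc : IsCompact (K : Set G)) (hK1 : K ≠ ⊥)
    (hUK : ∀ u ∈ U, ∀ m ∈ K, u * m * u⁻¹ ∈ K) (hK : IsLocallyCommensurated K) :
    ∃ (Q : Subgroup K) (_ : Q.Normal), IsOpen (Q : Set K) ∧
      ∃ V : Subgroup G, IsOpen (V : Set G) ∧
        ∀ X : ∀ (H : Type u) [Group H], Prop, IsGroupClass X → X (K ⧸ Q) → IsProClass X V := by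
  have := hG.totallyDisconnected
  have hKJ : K ≤ hK.centralizing := by
    intro k hk
    filter_upwards [hUo.mem_nhds U.one_mem] with u hu
    have := K.mul_mem (K.inv_mem hk) (hUK u hu k hk)
    simpa [mul_assoc] using this
  obtain ⟨S, hSf, hSJ, hSinv, hS⟩ := hG.exists_finite_generating hK.centralizing_normal
    (fun h => hK1 (le_bot_iff.1 (h ▸ hKJ))) hUo
  let Ω : Set G := {x | ∃ k ∈ K, ∃ u ∈ U, ∃ s ∈ S, ∃ k' ∈ K, x = k * (u * s * u⁻¹) * k'}
  have hΩl : ∀ k ∈ K, ∀ x ∈ Ω, k * x ∈ Ω := by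
    rintro k₁ hk₁ _ ⟨k, hk, u, hu, s, hs, k', hk', rfl⟩
    exact ⟨k₁ * k, K.mul_mem hk₁ hk, u, hu, s, hs, k', hk', by simp only [mul_assoc]⟩
  have hSΩ : ∀ u ∈ U, ∀ s ∈ S, u * s * u⁻¹ ∈ Ω := fun u hu s hs =>
    ⟨1, K.one_mem, u, hu, s, hs, 1, K.one_mem, by simp⟩
  obtain ⟨T, hTΩ, hTf, hT⟩ := exists_finite_cosets hUc hKc hUK hK hSf hSJ
    (fun x (hx : x ∈ Ω) => hx)
  have hTJ : ∀ t ∈ T, t ∈ hK.centralizing := by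
    intro t ht
    obtain ⟨k, hk, u, hu, s, hs, k', hk', rfl⟩ := hTΩ ht
    exact Subgroup.mul_mem _ (Subgroup.mul_mem _ (hKJ hk)
      (hK.centralizing_normal.conj_mem s (hSJ hs) u)) (hKJ hk')
  -- Q is normal since KΩ = Ω, and open since the finite set T of coset representatives suffices to
  -- test membership.
  let Q : Subgroup K :=
    { carrier := {x | ∀ s ∈ Ω, s⁻¹ * (x : G) * s ∈ K}
      one_mem' := fun s _ => by simp [K.one_mem]
      mul_mem' := fun {a b} ha hb s hs => by
        have := K.mul_mem (ha s hs) (hb s hs)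
        simpa [mul_assoc] using this
      inv_mem' := fun {a} ha s hs => by
        have := K.inv_mem (ha s hs)
        simpa [mul_assoc] using this }
  have hQmem : ∀ x : K, x ∈ Q ↔ ∀ s ∈ Ω, s⁻¹ * (x : G) * s ∈ K := fun x => Iff.rfl
  have hQ : Q.Normal := by
    refine ⟨fun q hq k s hs => ?_⟩
    have := hq _ (hΩl (k : G)⁻¹ (K.inv_mem k.2) s hs)
    simpa [mul_assoc] using this
  have hQo : IsOpen (Q : Set K) := by
    refine Q.isOpen_of_mem_nhds (g := 1) ?_
    have hev : ∀ᶠ x in 𝓝 (1 : G), ∀ t ∈ T, x ∈ K → t⁻¹ * x * t⁻¹⁻¹ ∈ K :=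
      (Filter.eventually_all_finite hTf).2 fun t _ => hK t⁻¹
    have hval : Filter.Tendsto (Subtype.val : K → G) (𝓝 1) (𝓝 1) :=
      continuous_subtype_val.tendsto (1 : K)
    filter_upwards [hval.eventually hev] with x hx s hs
    obtain ⟨t, ht, k, hk, rfl⟩ := hT s hs
    have := K.mul_mem (K.mul_mem (K.inv_mem hk) (hx t ht x.2)) hk
    simpa [mul_assoc] using this
  have hev : ∀ᶠ u in 𝓝 (1 : G), ∀ t ∈ T, t⁻¹ * u * t * u⁻¹ ∈ K :=
    (Filter.eventually_all_finite hTf).2 hTJ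
  obtain ⟨V, hVU, hVo, hV, -⟩ := exists_open_normalized_subgroup hUo hUc hev
  have hVΩ : ∀ u ∈ V, ∀ s ∈ Ω, s⁻¹ * u * s * u⁻¹ ∈ K := by
    intro u hu s hs
    obtain ⟨t, ht, k, hk, rfl⟩ := hT s hs
    have := K.mul_mem (K.mul_mem (K.inv_mem hk) (hV hu t ht)) (hUK u (hVU hu) k hk)
    simpa [mul_assoc] using this
  refine ⟨Q, hQ, hQo, V, hVo, fun X hX hXQ => ?_⟩
  have hVcs : CompactSpace V := isCompact_iff_compactSpace.1
    (hUc.of_isClosed_subset (V.isClosed_of_isOpen hVo) hVU)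
  refine IsProClass.of_perfect_eq_bot hX fun R _ _ hR => ?_
  -- Put c(r) = h⁻¹rhr⁻¹, so that c(ab) = c(a)·ac(b)a⁻¹. Since V acts trivially on K/Q, c is a
  -- homomorphism modulo Q. As R has no nontrivial X-quotient, c takes values in Q, and conjugation
  -- by s then keeps them in K.
  have hstep : ∀ h : G, (∀ r : R, h⁻¹ * (r : V) * h * (r : V)⁻¹ ∈ K) → ∀ s ∈ Ω, ∀ r : R,
      (h * s)⁻¹ * (r : V) * (h * s) * ((r : V) : G)⁻¹ ∈ K := by
    intro h hh s hs
    let c : R → K := fun r => ⟨h⁻¹ * (r : V) * h * ((r : V) : G)⁻¹, hh r⟩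
    have hc : Continuous c := by
      refine Continuous.subtype_mk ?_ _
      fun_prop
    let f : R →* K ⧸ Q := MonoidHom.mk' (fun r => QuotientGroup.mk (c r)) (by
      intro a b
      refine (QuotientGroup.eq.2 ?_).symm
      rw [hQmem]
      intro t ht
      have h1 := hVΩ (a : V) (a : V).2 (c b * t) (hΩl _ (c b).2 t ht)
      have h2 := hVΩ (a : V) (a : V).2 t ht
      refine (congrArg (· ∈ K) ?_).mp (K.mul_mem h1 (K.inv_mem h2))
      simp only [c, Subgroup.coe_mul, Subgroup.coe_inv]
      group)
    have hf : ∀ r, f r = 1 := by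
      refine hR _ f hXQ ?_
      have : (f.ker : Set R) = c ⁻¹' (Q : Set K) := by
        ext r
        exact QuotientGroup.eq_one_iff (N := Q) (c r)
      rw [this]
      exact hQo.preimage hc
    intro r
    have hr : c r ∈ Q := (QuotientGroup.eq_one_iff (N := Q) (c r)).1 (hf r)
    refine (congrArg (· ∈ K) ?_).mp (K.mul_mem (hr s hs) (hVΩ (r : V) (r : V).2 s hs))
    simp only [c]
    group
  -- Letters from U are moved to the right: t·v·y = t·(vyv⁻¹)·v with vyv⁻¹ in Ω. Since S is
  -- symmetric, inverses of Ω are not needed.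
  have hdecomp : ∀ g : G, ∃ t : G, (∀ r : R, t⁻¹ * (r : V) * t * ((r : V) : G)⁻¹ ∈ K) ∧
      ∃ v ∈ U, g = t * v := by
    intro g
    have hg : g ∈ Subgroup.closure (S ∪ (U : Set G)) := by rw [hS]; trivial
    have hmul : ∀ x y : G, y ∈ S ∪ (U : Set G) →
        (∃ t : G, (∀ r : R, t⁻¹ * (r : V) * t * ((r : V) : G)⁻¹ ∈ K) ∧ ∃ v ∈ U, x = t * v) →
        ∃ t : G, (∀ r : R, t⁻¹ * (r : V) * t * ((r : V) : G)⁻¹ ∈ K) ∧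
          ∃ v ∈ U, x * y = t * v := by
      rintro x y (hy | hy) ⟨t, ht, v, hv, rfl⟩
      · exact ⟨t * (v * y * v⁻¹), hstep t ht _ (hSΩ v hv y hy), v, hv, by simp [mul_assoc]⟩
      · exact ⟨t, ht, v * y, U.mul_mem hv hy, by rw [mul_assoc]⟩
    induction hg using Subgroup.closure_induction_right with
    | one => exact ⟨1, fun r => by simp [K.one_mem], 1, U.one_mem, by simp⟩
    | mul_right x _ y hy ih => exact hmul x y hy ih
    | mul_inv_cancel x _ y hy ih =>
      refine hmul x y⁻¹ ?_ ih
      rcases hy with hy | hy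
      · exact Or.inl (hSinv y hy)
      · exact Or.inr (U.inv_mem hy)
  have hcore : U.normalCore = ⊥ := by
    refine hG.eq_bot_of_isCompact_of_normal inferInstance ?_
    exact hUc.of_isClosed_subset (U.normalCore_isClosed (U.isClosed_of_isOpen hUo)) U.normalCore_le
  rw [eq_bot_iff]
  intro r hr
  -- Conjugating r by the Ω-part lands in Kr ⊆ U, and the remaining factor lies in U.
  have hrU : (r : G) ∈ U.normalCore := by
    intro g
    obtain ⟨t, ht, v, hv, hg⟩ := hdecomp g⁻¹
    have h1 : t⁻¹ * (r : G) * t ∈ U := by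
      have := U.mul_mem (hKU (ht ⟨r, hr⟩)) (hVU r.2)
      simpa using this
    have h2 := U.mul_mem (U.mul_mem (U.inv_mem hv) h1) hv
    have e : g = v⁻¹ * t⁻¹ := by rw [← inv_inv g, hg, mul_inv_rev]
    rw [e]
    simpa [mul_assoc] using h2
  rw [hcore] at hrU
  exact Subtype.ext hrU

end Commensurated

theorem IsPro.mono_primes {H : Type*} [Group H] [TopologicalSpace H] [IsTopologicalGroup H]
    {η η' : Set ℕ} (h : η ⊆ η') (hH : IsPro η H) : IsPro η' H :=
  ⟨hH.1, fun N hN hNo p hp hd => h (hH.2 N hN hNo p hp hd)⟩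

/-! ### Sylow subgroups of profinite groups -/

section Sylow

variable {H : Type u} [Group H] [TopologicalSpace H] [CompactSpace H]

/-- A minimal closed subgroup of index prime to `p` in a profinite group. -/
theorem exists_minimal_closed_not_dvd_index (p : ℕ) (hp : p.Prime) :
    ∃ P : Subgroup H, Minimal (fun P : Subgroup H => IsClosed (P : Set H) ∧
      ∀ O : Subgroup H, IsOpen (O : Set H) → P ≤ O → ¬ p ∣ O.index) P := by
  obtain ⟨P, -, hP⟩ := zorn_le_nonempty₀ (α := (Subgroup H)ᵒᵈ)
    {P | IsClosed ((OrderDual.ofDual P : Subgroup H) : Set H) ∧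
      ∀ O : Subgroup H, IsOpen (O : Set H) → (OrderDual.ofDual P : Subgroup H) ≤ O →
        ¬ p ∣ O.index} (by
    intro c hcs hc P₀ hP₀
    let Q : Subgroup H := ⨅ P : c, (OrderDual.ofDual P.1 : Subgroup H)
    have hQcoe : (Q : Set H) = ⋂ P : c, ((OrderDual.ofDual P.1 : Subgroup H) : Set H) :=
      Subgroup.coe_iInf
    refine ⟨OrderDual.toDual Q, ⟨?_, ?_⟩, fun P hP => ?_⟩
    · change IsClosed (Q : Set H)
      rw [hQcoe]
      exact isClosed_iInter fun P => (hcs P.2).1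
    · intro O hO hQO
      have : Nonempty c := ⟨⟨P₀, hP₀⟩⟩
      -- By compactness, an open subgroup containing the intersection of the chain contains a member
      -- of it.
      obtain ⟨P, hP⟩ := hO.isClosed_compl.isCompact.elim_directed_family_closed
        (fun P : c => ((OrderDual.ofDual P.1 : Subgroup H) : Set H)) (fun P => (hcs P.2).1) (by
          rw [← hQcoe, Set.eq_empty_iff_forall_notMem]
          rintro x ⟨hx, hxQ⟩
          exact hx (hQO hxQ)) (by
          intro P P'
          rcases hc.total P.2 P'.2 with h | h
          · exact ⟨P', h, subset_rfl⟩
          · exact ⟨P, subset_rfl, h⟩)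
      refine (hcs P.2).2 O hO fun x hx => ?_
      by_contra hxO
      exact Set.eq_empty_iff_forall_notMem.1 hP x ⟨hxO, hx⟩
    · exact (iInf_le (fun P : c => (OrderDual.ofDual P.1 : Subgroup H)) ⟨P, hP⟩ :))
    (OrderDual.toDual ⊤) ⟨isClosed_univ, fun O _ hO => by
      have : O = ⊤ := top_le_iff.1 hO
      rw [this, Subgroup.index_top]
      exact hp.one_lt.ne' ∘ Nat.dvd_one.1⟩
  exact ⟨OrderDual.ofDual P, hP.1, fun Q hQ hQP => hP.2 (y := OrderDual.toDual Q) hQ hQP⟩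

variable [IsTopologicalGroup H] [TotallyDisconnectedSpace H]

/-- A profinite group has a closed pro-`p` subgroup of index prime to `p`. -/
theorem exists_isPro_singleton_not_dvd_index (p : ℕ) (hp : p.Prime) :
    ∃ P : Subgroup H, IsPro {p} P ∧
      ∀ O : Subgroup H, IsOpen (O : Set H) → P ≤ O → ¬ p ∣ O.index := by
  obtain ⟨P, ⟨hPc, hPi⟩, hmin⟩ := exists_minimal_closed_not_dvd_index (H := H) p hp
  have hPcs : CompactSpace P := isCompact_iff_compactSpace.1 hPc.isCompact
  refine ⟨P, ⟨⟨hPcs, inferInstance⟩, fun M hM hMo q hq hd => ?_⟩, hPi⟩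
  have : Finite (P ⧸ M) := Subgroup.quotient_finite_of_isOpen M hMo
  have : Fact p.Prime := ⟨hp⟩
  have : Fact q.Prime := ⟨hq⟩
  -- The preimage T of a Sylow subgroup of P/M still has index prime to p in H, so minimality gives
  -- T = P and P/M is a p-group.
  let S : Sylow p (P ⧸ M) := default
  let T : Subgroup P := (S : Subgroup (P ⧸ M)).comap (QuotientGroup.mk' M)
  have hMT : M ≤ T := fun x hx => by
    have : (QuotientGroup.mk' M) x = 1 := (QuotientGroup.eq_one_iff x).2 hx
    change (QuotientGroup.mk' M) x ∈ (S : Subgroup (P ⧸ M))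
    rw [this]
    exact Subgroup.one_mem _
  have hTo : IsOpen (T : Set P) := Subgroup.isOpen_mono hMT hMo
  have hTi : ¬ p ∣ T.index := by
    rw [Subgroup.index_comap_of_surjective _ (QuotientGroup.mk'_surjective M)]
    exact S.not_dvd_index
  let Q : Subgroup H := T.map P.subtype
  have hQP : Q ≤ P := Subgroup.map_subtype_le T
  have hQc : IsClosed (Q : Set H) :=
    hPc.isClosedEmbedding_subtypeVal.isClosedMap _ (T.isClosed_of_isOpen hTo)
  have hQi : ∀ O : Subgroup H, IsOpen (O : Set H) → Q ≤ O → ¬ p ∣ O.index := by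
    intro O hO hQO hdvd
    -- Modulo an open normal N ≤ O, the index of Q factors as [PN : QN]·[H : PN], where the first
    -- factor divides [P : T].
    obtain ⟨N, hN, hNo, hNO⟩ := exists_open_normal_le (hO.mem_nhds O.one_mem)
    have h1 : ¬ p ∣ (P.map (QuotientGroup.mk' N)).index := by
      rw [← Subgroup.index_comap_of_surjective _ (QuotientGroup.mk'_surjective N)]
      refine hPi _ (Subgroup.isOpen_mono (H₁ := N) ?_ hNo) (Subgroup.le_comap_map _ _)
      intro x hx
      have : (QuotientGroup.mk' N) x = 1 := (QuotientGroup.eq_one_iff x).2 hx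
      change (QuotientGroup.mk' N) x ∈ P.map (QuotientGroup.mk' N)
      rw [this]
      exact Subgroup.one_mem _
    have h2 : (Q.map (QuotientGroup.mk' N)).relIndex (P.map (QuotientGroup.mk' N)) ∣ T.index := by
      have h3 : T.index = Q.relIndex P := by
        have : Q.subgroupOf P = T := Subgroup.comap_map_eq_self_of_injective P.subtype_injective T
        rw [Subgroup.relIndex, this]
      rw [h3, ← Subgroup.relIndex_comap, Subgroup.comap_map_eq]
      exact Subgroup.relIndex_dvd_of_le_left _ le_sup_left
    have h4 : ¬ p ∣ (Q.map (QuotientGroup.mk' N)).index := by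
      rw [← Subgroup.relIndex_mul_index (Subgroup.map_mono hQP), hp.dvd_mul]
      rintro (h | h)
      · exact hTi (h.trans h2)
      · exact h1 h
    rw [← Subgroup.index_comap_of_surjective _ (QuotientGroup.mk'_surjective N)] at h4
    refine h4 (hdvd.trans (Subgroup.index_dvd_of_le ?_))
    rw [Subgroup.comap_map_eq, QuotientGroup.ker_mk']
    exact sup_le hQO hNO
  have hPQ : P ≤ Q := hmin ⟨hQc, hQi⟩ hQP
  have hT : T = ⊤ := by
    rw [eq_top_iff]
    intro x _
    obtain ⟨y, hy, hyx⟩ := hPQ x.2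
    rwa [Subtype.ext hyx] at hy
  have hS : (S : Subgroup (P ⧸ M)) = ⊤ := by
    rw [eq_top_iff]
    intro y _
    obtain ⟨x, rfl⟩ := QuotientGroup.mk'_surjective M y
    have : x ∈ T := by rw [hT]; trivial
    exact this
  have hpg : IsPGroup p (P ⧸ M) := by
    have := S.isPGroup'
    rw [hS] at this
    exact this.of_equiv Subgroup.topEquiv
  obtain ⟨n, hn⟩ := IsPGroup.iff_card.1 hpg
  rw [hn] at hd
  exact (Nat.prime_dvd_prime_iff_eq hq hp).1 (hq.dvd_of_dvd_pow hd)

/-- A profinite group either contains an infinite pro-`p` subgroup or has an open subgroup all of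
whose finite continuous quotients have order prime to `p`. -/
theorem exists_infinite_isPro_singleton_or (p : ℕ) (hp : p.Prime) :
    (∃ P : Subgroup H, Infinite P ∧ IsPro {p} P) ∨
      ∃ N : Subgroup H, IsOpen (N : Set H) ∧ IsPro {q | q ≠ p} N := by
  obtain ⟨P, hP, hPi⟩ := exists_isPro_singleton_not_dvd_index (H := H) p hp
  rcases finite_or_infinite P with hfin | hinf
  swap
  · exact Or.inl ⟨P, hinf, hP⟩
  right
  have hfs : ((P : Set H) \ {1}).Finite := (Set.toFinite (P : Set H)).subset Set.sdiff_subset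
  obtain ⟨N, hN, hNo, hNP⟩ := exists_open_normal_le (V := ((P : Set H) \ {1})ᶜ)
    (hfs.isClosed.isOpen_compl.mem_nhds (by simp))
  have hinf : ∀ N' : Subgroup H, N' ≤ N → N' ⊓ P = ⊥ := by
    intro N' hN'
    rw [eq_bot_iff]
    rintro x ⟨hxN, hxP⟩
    by_contra hx
    exact hNP (hN' hxN) ⟨hxP, hx⟩
  have hNcs : CompactSpace N := isCompact_iff_compactSpace.1 (N.isClosed_of_isOpen hNo).isCompact
  refine ⟨N, hNo, ⟨⟨hNcs, inferInstance⟩, ?_⟩⟩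
  rintro K hK hKo q hq hd rfl
  have h1 : ((K.map N.subtype : Subgroup H) : Set H) ∈ 𝓝 (1 : H) :=
    (hNo.isOpenMap_subtype_val _ hKo).mem_nhds ⟨1, K.one_mem, rfl⟩
  obtain ⟨M, hM, hMo, hMK⟩ := exists_open_normal_le h1
  have hMN : M ≤ N := fun x hx => Subgroup.map_subtype_le K (hMK hx)
  have hcardP : Nat.card P ≠ 0 := Nat.card_pos.ne'
  -- As P meets N' trivially, [H : N'] = |P|·[H : PN']. Comparing M with N, the index [N : M]
  -- divides [H : PM], which is prime to p.
  have hcard : ∀ N' : Subgroup H, N'.Normal → N' ≤ N →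
      N'.index = Nat.card P * (P ⊔ N').index := by
    intro N' hN' hle
    rw [← Subgroup.relIndex_mul_index (le_sup_right : N' ≤ P ⊔ N'), Subgroup.relIndex_sup_right,
      ← Subgroup.inf_relIndex_right, hinf N' hle, Subgroup.relIndex_bot_left]
  have h2 : M.relIndex N * (P ⊔ N).index = (P ⊔ M).index := by
    have h3 := Subgroup.relIndex_mul_index hMN
    rw [hcard M hM hMN, hcard N hN le_rfl, mul_left_comm] at h3
    exact Nat.eq_of_mul_eq_mul_left (Nat.pos_of_ne_zero hcardP) h3
  have h5 : q ∣ M.relIndex N := by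
    have hKi : K.index ∣ M.relIndex N := by
      refine Subgroup.index_dvd_of_le (H := M.subgroupOf N) fun x hx => ?_
      obtain ⟨y, hy, hyx⟩ := hMK hx
      rwa [Subtype.ext hyx] at hy
    exact hd.trans hKi
  exact hPi (P ⊔ M) (Subgroup.isOpen_mono le_sup_right hMo) le_sup_left
    (h2 ▸ h5.mul_right _)

end Sylow

/-! ### Locally normal subgroups: the prime content and prosolubility -/

section LocallyNormal

variable {G : Type u} [Group G] [TopologicalSpace G]

theorem Subgroup.exists_nhds_le_map_subtype {L : Subgroup G} {N : Subgroup L}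
    (hN : IsOpen (N : Set L)) :
    ∃ V ∈ 𝓝 (1 : G), ∀ A : Subgroup G, A ≤ L → (A : Set G) ⊆ V → A ≤ N.map L.subtype := by
  have h1 : (N : Set L) ∈ 𝓝 (1 : L) := hN.mem_nhds N.one_mem
  rw [nhds_induced] at h1
  obtain ⟨V, hV, hVN⟩ := h1
  exact ⟨V, hV, fun A hAL hAV a ha => ⟨⟨a, hAL ha⟩, hVN (hAV ha), rfl⟩⟩

theorem IsLocallyNormal.eventually_conj_mem {L : Subgroup G} (hL : IsLocallyNormal L) :
    ∀ᶠ g in 𝓝 (1 : G), ∀ l ∈ L, g * l * g⁻¹ ∈ L := by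
  filter_upwards [hL.2.mem_nhds (Subgroup.one_mem _)] with g hg l hl
  exact (Subgroup.mem_normalizer_iff.1 hg l).1 hl

variable [IsTopologicalGroup G]

theorem IsProClass.of_le_map_subtype {X : ∀ (H : Type u) [Group H], Prop} (hX : IsGroupClass X)
    {L : Subgroup G} {N : Subgroup L} (hN : IsProClass X N) {A : Subgroup G}
    (hA : IsCompact (A : Set G)) (hAN : A ≤ N.map L.subtype) : IsProClass X A := by
  have : CompactSpace A := isCompact_iff_compactSpace.1 hA
  have hmem : ∀ a : A, ∃ h : (a : G) ∈ L, (⟨a, h⟩ : L) ∈ N := fun a => by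
    obtain ⟨y, hy, hya⟩ := hAN a.2
    have hL : (a : G) ∈ L := hya ▸ y.2
    have e : (⟨a, hL⟩ : L) = y := Subtype.ext hya.symm
    exact ⟨hL, e ▸ hy⟩
  let f : A →* N := MonoidHom.mk' (fun a => ⟨⟨a, (hmem a).1⟩, (hmem a).2⟩) fun a b => rfl
  refine IsProClass.of_injective hX f ?_ ?_ hN
  · exact Continuous.subtype_mk (Continuous.subtype_mk continuous_subtype_val _) _
  · intro a b hab
    exact Subtype.ext (congrArg (fun z : N => ((z : L) : G)) hab)

theorem finiteIndex_and_isProClass_subgroupOf {X : ∀ (H : Type u) [Group H], Prop}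
    (hX : IsGroupClass X) {L W : Subgroup G} (hL : IsCompact (L : Set G))
    (hW : IsOpen (W : Set G)) (hWX : IsProClass X W) :
    (W.subgroupOf L).FiniteIndex ∧ IsProClass X (W.subgroupOf L) := by
  have : CompactSpace L := isCompact_iff_compactSpace.1 hL
  have ho : IsOpen (W.subgroupOf L : Set L) := hW.preimage continuous_subtype_val
  have : Finite (L ⧸ W.subgroupOf L) := Subgroup.quotient_finite_of_isOpen _ ho
  have : CompactSpace (W.subgroupOf L) :=
    isCompact_iff_compactSpace.1 ((W.subgroupOf L).isClosed_of_isOpen ho).isCompact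
  refine ⟨Subgroup.finiteIndex_of_finite_quotient, ?_⟩
  let f : W.subgroupOf L →* W := MonoidHom.mk' (fun a => ⟨(a : L), a.2⟩) fun a b => rfl
  refine IsProClass.of_injective hX f ?_ ?_ hWX
  · exact Continuous.subtype_mk (continuous_subtype_val.comp continuous_subtype_val) _
  · intro a b hab
    exact Subtype.ext (Subtype.ext (congrArg (fun z : W => (z : G)) hab))

namespace InClassS

theorem inf_ne_bot (hG : InClassS G) {L V : Subgroup G}
    (hL : ∀ᶠ g in 𝓝 (1 : G), ∀ l ∈ L, g * l * g⁻¹ ∈ L) (hL1 : L ≠ ⊥)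
    (hV : IsOpen (V : Set G)) : L ⊓ V ≠ ⊥ := fun h =>
  hL1 (hG.eq_bot_of_inf_eq_bot hL (hV.mem_nhds V.one_mem) fun l hl hlV => by
    have : l ∈ L ⊓ V := ⟨hl, hlV⟩
    rwa [h] at this)

theorem exists_inf_normalized (hG : InClassS G) {L : Subgroup G} (hL : IsLocallyNormal L)
    (hL1 : L ≠ ⊥) {V : Set G} (hV : V ∈ 𝓝 (1 : G)) :
    ∃ U : Subgroup G, IsOpen (U : Set G) ∧ IsCompact (U : Set G) ∧ (U : Set G) ⊆ V ∧
      L ⊓ U ≠ ⊥ ∧ IsCompact ((L ⊓ U : Subgroup G) : Set G) ∧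
      ∀ u ∈ U, ∀ a ∈ L ⊓ U, u * a * u⁻¹ ∈ L ⊓ U := by
  have := hG.totallyDisconnected
  have := hG.locallyCompact
  obtain ⟨U, hUo, hUc, hU⟩ := exists_open_compact_subgroup
    (Filter.inter_mem hV hL.eventually_conj_mem)
  exact ⟨U, hUo, hUc, hU.trans Set.inter_subset_left,
    hG.inf_ne_bot hL.eventually_conj_mem hL1 hUo, hL.1.subgroup_inf_open hUo,
    fun u hu a ha => ⟨(hU hu).2 a ha.1, U.mul_mem (U.mul_mem hu ha.2) (U.inv_mem hu)⟩⟩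

/-- If the small compact subgroups of a nontrivial locally normal subgroup are pro-`X`, then so is
some open subgroup. -/
theorem exists_open_isProClass_of_isLocallyNormal (hG : InClassS G)
    {X : ∀ (H : Type u) [Group H], Prop} (hX : IsGroupClass X) {L : Subgroup G}
    (hL : IsLocallyNormal L) (hL1 : L ≠ ⊥) {V : Set G} (hV : V ∈ 𝓝 (1 : G))
    (h : ∀ A : Subgroup G, IsCompact (A : Set G) → A ≤ L → (A : Set G) ⊆ V → IsProClass X A) :
    ∃ W : Subgroup G, IsOpen (W : Set G) ∧ IsProClass X W := by
  have := hG.totallyDisconnected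
  obtain ⟨U, hUo, hUc, hUV, hA1, hAc, hUA⟩ := hG.exists_inf_normalized hL hL1 hV
  have hAX : IsProClass X (L ⊓ U : Subgroup G) :=
    h _ hAc inf_le_left (Set.Subset.trans (inf_le_right : L ⊓ U ≤ U) hUV)
  obtain ⟨𝒜, W, h𝒜, hA𝒜, hconj, hU𝒜, hgen, hWU, hWo, hUW, hW𝒜⟩ :=
    hG.exists_finite_conjugates hUo hUc hA1 hUA
  have hM : IsProClass X (⨆ B ∈ 𝒜, B ⊓ W : Subgroup G) := by
    refine isProClass_iSup_inf hX h𝒜 hWo hW𝒜 fun B hB => ?_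
    obtain ⟨g, rfl⟩ := hconj B hB
    refine hAX.map hX _ ?_
    exact (continuous_const.mul continuous_id).mul continuous_const
  have hM1 : (⨆ B ∈ 𝒜, B ⊓ W : Subgroup G) ≠ ⊥ := by
    intro h0
    refine hG.inf_ne_bot ?_ hA1 hWo (le_bot_iff.1 (h0 ▸ ?_))
    · filter_upwards [hUo.mem_nhds U.one_mem] with u hu using hUA u hu
    · exact le_iSup₂_of_le (f := fun (B : Subgroup G) (_ : B ∈ 𝒜) => B ⊓ W) _ hA𝒜 le_rfl
  obtain ⟨Q, hQ, hQo, W', hW'o, hW'⟩ := hG.exists_open_isProClass hUo hUc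
    (iSup₂_le fun B _ => inf_le_right.trans hWU) hM.isCompact hM1 (conj_mem_iSup_inf hU𝒜 hUW)
    (isLocallyCommensurated_iSup_inf hU𝒜 hgen hWo hUW hW𝒜)
  exact ⟨W', hW'o, hW' X hX (hM.2 Q hQo)⟩

theorem exists_open_isPro_finite (hG : InClassS G) :
    ∃ π : Set ℕ, π.Finite ∧ ∃ V : Subgroup G, IsOpen (V : Set G) ∧ IsPro π V := by
  have := hG.totallyDisconnected
  have := hG.locallyCompact
  obtain ⟨U, hUo, hUc, -⟩ := exists_open_compact_subgroup (G := G) Filter.univ_mem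
  have hU1 : U ≠ ⊥ := by
    rintro rfl
    exact hG.nonDiscrete (discreteTopology_of_isOpen_singleton_one hUo)
  have hconj : ∀ u ∈ U, ∀ m ∈ U, u * m * u⁻¹ ∈ U := fun u hu m hm =>
    U.mul_mem (U.mul_mem hu hm) (U.inv_mem hu)
  obtain ⟨Q, hQ, hQo, V, hVo, hV⟩ := hG.exists_open_isProClass hUo hUc le_rfl hUc hU1 hconj
    (fun g => by
      filter_upwards [tendsto_conj_one g (hUo.mem_nhds U.one_mem)] with x hx _ using hx)
  have : CompactSpace U := isCompact_iff_compactSpace.1 hUc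
  have : Finite (U ⧸ Q) := Subgroup.quotient_finite_of_isOpen Q hQo
  -- All divisors of |U/Q| are admitted; composite ones are harmless and keep the set finite.
  refine ⟨{p | p ∣ Nat.card (U ⧸ Q)}, ?_, V, hVo, ?_⟩
  · exact (Nat.divisors (Nat.card (U ⧸ Q))).finite_toSet.subset fun p hp =>
      Finset.mem_coe.2 (Nat.mem_divisors.2 ⟨hp, Nat.card_pos.ne'⟩)
  · exact isProClass_primes_iff.1 (hV _ (isGroupClass_primes _) ⟨inferInstance, fun p _ hd => hd⟩)

end InClassS

theorem IsPro.mono {η : Set ℕ} {M N : Subgroup G} (h : IsPro η N) (hMN : M ≤ N)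
    (hM : IsCompact (M : Set G)) : IsPro η M :=
  isProClass_primes_iff.1 ((isProClass_primes_iff.2 h).mono (isGroupClass_primes η) hMN hM)

/-- The local prime content: the primes `p` such that every open subgroup involves `p`. -/
def localPrimeContent (G : Type u) [Group G] [TopologicalSpace G] [IsTopologicalGroup G] : Set ℕ :=
  {p | p.Prime ∧ ∀ V : Subgroup G, IsOpen (V : Set G) → ¬ IsPro {q | q ≠ p} V}

namespace InClassS

/-- Each of the finitely many superfluous primes of an open pro-π subgroup is avoided by some open
subgroup; intersecting these removes them all. -/
theorem exists_isPro_localPrimeContent (hG : InClassS G) :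
    (localPrimeContent G).Finite ∧
      ∃ V : Subgroup G, IsOpen (V : Set G) ∧ IsPro (localPrimeContent G) V := by
  have := hG.totallyDisconnected
  have := hG.locallyCompact
  obtain ⟨π, hπ, V, hVo, hV⟩ := hG.exists_open_isPro_finite
  refine ⟨hπ.subset fun p hp => ?_, ?_⟩
  · by_contra hpπ
    exact hp.2 V hVo (hV.mono_primes fun q hq hqp => hpπ (hqp ▸ hq))
  have hex : ∀ p ∈ π, ∃ W : Subgroup G, IsOpen (W : Set G) ∧
      (p.Prime → p ∉ localPrimeContent G → IsPro {q | q ≠ p} W) := by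
    intro p _
    by_cases hp : p.Prime ∧ p ∉ localPrimeContent G
    · have h2 : ¬ ∀ V : Subgroup G, IsOpen (V : Set G) → ¬ IsPro {q | q ≠ p} V :=
        fun h => hp.2 ⟨hp.1, h⟩
      push Not at h2
      obtain ⟨W, hWo, hW⟩ := h2
      exact ⟨W, hWo, fun _ _ => hW⟩
    -- No condition is imposed for this p, so ⊤ is a mere default.
    · exact ⟨⊤, isOpen_univ, fun h1 h2 => (hp ⟨h1, h2⟩).elim⟩
  choose! W hWo hW using hex
  obtain ⟨V', hV'o, hV'c, hV'⟩ := exists_open_compact_subgroup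
    (Filter.inter_mem (hVo.mem_nhds V.one_mem)
      ((Filter.biInter_mem hπ).2 fun p hp => (hWo p hp).mem_nhds (W p).one_mem))
  have hV'V : V' ≤ V := fun x hx => (hV' hx).1
  refine ⟨V', hV'o, ⟨(hV.mono hV'V hV'c).1, fun N hN hNo p hp hd => ?_⟩⟩
  by_contra hpη
  have hpπ : p ∈ π := (hV.mono hV'V hV'c).2 N hN hNo p hp hd
  have hV'W : V' ≤ W p := fun x hx => Set.mem_iInter₂.1 (hV' hx).2 p hpπ
  exact ((hW p hpπ hp hpη).mono hV'W hV'c).2 N hN hNo p hp hd rfl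

theorem hasBasis_isPro_localPrimeContent (hG : InClassS G) :
    (𝓝 (1 : G)).HasBasis
      (fun V : Subgroup G => IsOpen (V : Set G) ∧ IsPro (localPrimeContent G) V)
      (fun V : Subgroup G => (V : Set G)) := by
  have := hG.totallyDisconnected
  have := hG.locallyCompact
  obtain ⟨-, W, hWo, hW⟩ := hG.exists_isPro_localPrimeContent
  refine ⟨fun t => ⟨fun ht => ?_, ?_⟩⟩
  · obtain ⟨V, hVo, hVc, hV⟩ := exists_open_compact_subgroup
      (Filter.inter_mem ht (hWo.mem_nhds W.one_mem))
    exact ⟨V, ⟨hVo, hW.mono (fun x hx => (hV hx).2) hVc⟩, fun x hx => (hV hx).1⟩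
  · rintro ⟨V, ⟨hVo, -⟩, hVt⟩
    exact Filter.mem_of_superset (hVo.mem_nhds V.one_mem) hVt

theorem isVirtuallyPro_localPrimeContent (hG : InClassS G) {L : Subgroup G}
    (hL : IsLocallyNormal L) : IsVirtuallyPro (localPrimeContent G) L := by
  obtain ⟨-, W, hWo, hW⟩ := hG.exists_isPro_localPrimeContent
  obtain ⟨h1, h2⟩ := finiteIndex_and_isProClass_subgroupOf (isGroupClass_primes _) hL.1 hWo
    (isProClass_primes_iff.2 hW)
  exact ⟨_, h1, isProClass_primes_iff.1 h2⟩

/-- Otherwise an open subgroup of L is pro-p', and hence so is an open subgroup of G, against the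
choice of p. -/
theorem exists_infinite_isPro_singleton (hG : InClassS G) {p : ℕ} (hp : p ∈ localPrimeContent G)
    {L : Subgroup G} (hL : IsLocallyNormal L) (hL1 : L ≠ ⊥) :
    ∃ P : Subgroup G, P ≤ L ∧ Infinite P ∧ IsPro {p} P := by
  have := hG.totallyDisconnected
  have : CompactSpace L := isCompact_iff_compactSpace.1 hL.1
  rcases exists_infinite_isPro_singleton_or (H := L) p hp.1 with ⟨P, hPinf, hP⟩ | ⟨N, hNo, hN⟩
  · refine ⟨P.map L.subtype, Subgroup.map_subtype_le P, ?_, ?_⟩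
    · exact (P.equivMapOfInjective L.subtype L.subtype_injective).toEquiv.infinite_iff.1 hPinf
    · have hPX := isProClass_primes_iff.2 hP
      refine isProClass_primes_iff.1 (hPX.of_le_map_subtype (isGroupClass_primes _) ?_ le_rfl)
      exact hPX.isCompact.image continuous_subtype_val
  · exfalso
    obtain ⟨V, hV, hVN⟩ := Subgroup.exists_nhds_le_map_subtype hNo
    obtain ⟨W, hWo, hW⟩ := hG.exists_open_isProClass_of_isLocallyNormal (isGroupClass_primes _)
      hL hL1 hV fun A hA hAL hAV =>
        (isProClass_primes_iff.2 hN).of_le_map_subtype (isGroupClass_primes _) hA (hVN A hAL hAV)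
    exact hp.2 W hWo (isProClass_primes_iff.1 hW)

theorem isVirtuallyProsoluble_of_isLocallyNormal (hG : InClassS G) {L : Subgroup G}
    (hL : IsLocallyNormal L) (hL1 : L ≠ ⊥) (hLs : IsVirtuallyProsoluble L) {U : Subgroup G}
    (hU : IsCompact (U : Set G)) : IsVirtuallyProsoluble U := by
  have := hG.totallyDisconnected
  obtain ⟨N, hNf, hN⟩ := hLs
  have hNX : IsProClass (fun H _ => Group.IsSolvable H) N := hN
  -- Compactness makes the finite-index subgroup closed, hence open in L, so small subgroups of L
  -- are prosoluble.
  have hNo : IsOpen (N : Set L) := N.isOpen_of_isClosed_of_finiteIndex hNX.isCompact.isClosed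
  obtain ⟨V, hV, hVN⟩ := Subgroup.exists_nhds_le_map_subtype hNo
  obtain ⟨W, hWo, hW⟩ := hG.exists_open_isProClass_of_isLocallyNormal isGroupClass_isSolvable
    hL hL1 hV fun A hA hAL hAV => hNX.of_le_map_subtype isGroupClass_isSolvable hA (hVN A hAL hAV)
  obtain ⟨h1, h2⟩ := finiteIndex_and_isProClass_subgroupOf isGroupClass_isSolvable hU hWo hW
  exact ⟨_, h1, h2⟩

end InClassS

end LocallyNormal

/-! ### Abelian and virtually soluble locally normal subgroups -/

section Soluble

open commutatorElement

section Commuting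

variable {G : Type u} [Group G]

/-- A finite family of subgroups, abelian inside `W` and normalised by `W`, is centralised by a
nontrivial part of any nontrivial subgroup normalised by `W`. -/
theorem exists_ne_bot_commuting {W : Subgroup G} {𝒜 : Set (Subgroup G)} (h𝒜 : 𝒜.Finite)
    (hW𝒜 : ∀ B ∈ 𝒜, ∀ w ∈ W, ∀ b ∈ B, w * b * w⁻¹ ∈ B)
    (hab : ∀ B ∈ 𝒜, ∀ a ∈ B, ∀ b ∈ B, a * b = b * a) {C : Subgroup G} (hC : C ≠ ⊥) (hCW : C ≤ W)
    (hWC : ∀ w ∈ W, ∀ c ∈ C, w * c * w⁻¹ ∈ C) :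
    ∃ C' : Subgroup G, C' ≠ ⊥ ∧ C' ≤ W ∧ (∀ w ∈ W, ∀ c ∈ C', w * c * w⁻¹ ∈ C') ∧
      ∀ B ∈ 𝒜, ∀ b ∈ B ⊓ W, ∀ c ∈ C', c * b = b * c := by
  induction 𝒜, h𝒜 using Set.Finite.induction_on with
  | empty => exact ⟨C, hC, hCW, hWC, by simp⟩
  | @insert B 𝒜 _ _ ih =>
    obtain ⟨C', hC', hCW', hWC', hcomm⟩ := ih (fun B hB => hW𝒜 B (Set.mem_insert_of_mem _ hB))
      (fun B hB => hab B (Set.mem_insert_of_mem _ hB))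
    have hWB := hW𝒜 B (Set.mem_insert _ _)
    have habB := hab B (Set.mem_insert _ _)
    -- If C' and B meet trivially, commutators of C' with B ∩ W lie in the intersection and vanish.
    -- Otherwise C' ∩ B can replace C', because B is abelian.
    by_cases hBC : C' ⊓ B = ⊥
    · refine ⟨C', hC', hCW', hWC', ?_⟩
      rintro B' (rfl | hB') b hb c hc
      · have h1 : c * b * c⁻¹ * b⁻¹ ∈ C' ⊓ B' := by
          refine ⟨?_, B'.mul_mem (hWB c (hCW' hc) b hb.1) (B'.inv_mem hb.1)⟩
          have := C'.mul_mem hc (hWC' b hb.2 c⁻¹ (C'.inv_mem hc))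
          simpa [mul_assoc] using this
        rw [hBC, Subgroup.mem_bot, mul_inv_eq_one, mul_inv_eq_iff_eq_mul] at h1
        exact h1
      · exact hcomm B' hB' b hb c hc
    · refine ⟨C' ⊓ B, hBC, inf_le_left.trans hCW',
        fun w hw c hc => ⟨hWC' w hw c hc.1, hWB w hw c hc.2⟩, ?_⟩
      rintro B' (rfl | hB') b hb c hc
      · exact habB c hc.2 b hb.1
      · exact hcomm B' hB' b hb c hc.1

end Commuting

variable {G : Type u} [Group G] [TopologicalSpace G] [IsTopologicalGroup G]

/-- Elements centralising a relatively open subset of `M`. -/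
def Subgroup.quasiCentralizer (M : Subgroup G) : Subgroup G where
  carrier := {x | ∀ᶠ y in 𝓝 (1 : G), y ∈ M → x * y = y * x}
  one_mem' := by simp
  mul_mem' := by
    intro a b ha hb
    filter_upwards [ha, hb] with y h1 h2 hy
    rw [mul_assoc, h2 hy, ← mul_assoc, h1 hy, mul_assoc]
  inv_mem' := by
    intro a ha
    filter_upwards [ha] with y h1 hy
    rw [inv_mul_eq_iff_eq_mul, ← mul_assoc, h1 hy]
    simp

theorem IsLocallyCommensurated.quasiCentralizer_normal {M : Subgroup G}
    (hM : IsLocallyCommensurated M) :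
    M.quasiCentralizer.Normal := by
  refine ⟨fun n hn g => ?_⟩
  filter_upwards [(tendsto_conj_one g⁻¹).eventually hn, hM g⁻¹] with y h1 h2 hy
  have := congrArg (fun z => g * z * g⁻¹) (h1 (h2 hy))
  simpa [mul_assoc] using this

/-- A compact abelian subgroup with open normaliser is trivial. -/
theorem InClassS.eq_bot_of_commutative (hG : InClassS G) {U A : Subgroup G}
    (hUo : IsOpen (U : Set G)) (hUc : IsCompact (U : Set G)) (hAc : IsCompact (A : Set G))
    (hUA : ∀ u ∈ U, ∀ a ∈ A, u * a * u⁻¹ ∈ A) (hA : ∀ a ∈ A, ∀ b ∈ A, a * b = b * a) : A = ⊥ := by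
  have := hG.totallyDisconnected
  by_contra hA1
  have hUA' : ∀ᶠ g in 𝓝 (1 : G), ∀ a ∈ A, g * a * g⁻¹ ∈ A := by
    filter_upwards [hUo.mem_nhds U.one_mem] with u hu using hUA u hu
  obtain ⟨𝒜, W, h𝒜, hA𝒜, hconj, hU𝒜, hgen, hWU, hWo, hUW, hW𝒜⟩ :=
    hG.exists_finite_conjugates hUo hUc hA1 hUA
  have hAM : A ⊓ W ≤ ⨆ B ∈ 𝒜, B ⊓ W :=
    le_iSup₂_of_le (f := fun (B : Subgroup G) (_ : B ∈ 𝒜) => B ⊓ W) _ hA𝒜 le_rfl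
  -- For the class of all groups pro-X just means profinite, so this yields compactness of the join.
  have hX : IsGroupClass.{u} (fun _ _ => True) :=
    ⟨fun _ _ _ => trivial, fun _ _ _ => trivial, fun _ _ _ _ _ => trivial⟩
  have hAX : IsProClass (fun _ _ => True) A :=
    ⟨⟨isCompact_iff_compactSpace.1 hAc, inferInstance⟩, fun _ _ _ => trivial⟩
  have hM : IsProClass (fun _ _ => True) (⨆ B ∈ 𝒜, B ⊓ W : Subgroup G) := by
    refine isProClass_iSup_inf hX h𝒜 hWo hW𝒜 fun B hB => ?_
    obtain ⟨g, rfl⟩ := hconj B hB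
    refine hAX.map hX _ ?_
    exact (continuous_const.mul continuous_id).mul continuous_const
  have hMc := isLocallyCommensurated_iSup_inf hU𝒜 hgen hWo hUW hW𝒜
  obtain ⟨C, hC, -, -, hCcomm⟩ := exists_ne_bot_commuting h𝒜 hW𝒜 (fun B hB a ha b hb => by
    obtain ⟨g, rfl⟩ := hconj B hB
    obtain ⟨a, ha, rfl⟩ := ha
    obtain ⟨b, hb, rfl⟩ := hb
    rw [← map_mul, hA a ha b hb, map_mul]) (hG.inf_ne_bot hUA' hA1 hWo) inf_le_right
    (fun w hw c hc => ⟨hUA w (hWU hw) c hc.1, W.mul_mem (W.mul_mem hw hc.2) (W.inv_mem hw)⟩)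
  have hCD : C ≤ (⨆ B ∈ 𝒜, B ⊓ W).quasiCentralizer := by
    intro c hc
    have hle : ⨆ B ∈ 𝒜, B ⊓ W ≤ Subgroup.centralizer {c} := iSup₂_le fun B hB b hb =>
      Subgroup.mem_centralizer_singleton_iff.2 (hCcomm B hB b hb c hc).symm
    exact Filter.Eventually.of_forall fun y hy =>
      (Subgroup.mem_centralizer_singleton_iff.1 (hle hy)).symm
  -- The quasi-centralizer of the join is normal and contains C ≠ 1, so the join is discrete; but it
  -- contains A ∩ W, which meets every open subgroup nontrivially.
  obtain ⟨V, hVo, hV⟩ := hG.exists_inf_eq_bot_of_centralising hUo hUc hM.isCompact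
    (conj_mem_iSup_inf hU𝒜 hUW) hMc.quasiCentralizer_normal
    (fun h => hC (le_bot_iff.1 (h ▸ hCD))) (fun d hd => hd)
  refine hG.inf_ne_bot (V := W ⊓ V) hUA' hA1 (hWo.inter hVo) (le_bot_iff.1 (hV ▸ ?_))
  exact fun x hx => ⟨hAM ⟨hx.1, hx.2.1⟩, hx.2.2⟩

theorem Subgroup.commutator_topologicalClosure_le (A : Subgroup G) :
    ⁅A.topologicalClosure, A.topologicalClosure⁆ ≤ ⁅A, A⁆.topologicalClosure := by
  rw [Subgroup.commutator_le]
  intro a ha b hb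
  exact map_mem_closure₂ (f := fun x y : G => ⁅x, y⁆)
    (by simp only [commutatorElement_def]; fun_prop) ha hb
    fun x hx y hy => Subgroup.commutator_mem_commutator hx hy

/-- The derived series formed with closures of commutator subgroups. -/
def closedDerivedSeries (A : Subgroup G) : ℕ → Subgroup G
  | 0 => A
  | n + 1 => ⁅closedDerivedSeries A n, closedDerivedSeries A n⁆.topologicalClosure

/-- The soluble subgroup of finite index need not be closed. Continuity of commutators lets its
closure inherit the bound on the derived length. -/
theorem closedDerivedSeries_le_of_le_topologicalClosure {A : Subgroup G} {V : Type*} [Group V]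
    (f : V →* G) (h : A ≤ f.range.topologicalClosure) (n : ℕ) :
    closedDerivedSeries A n ≤ ((derivedSeries V n).map f).topologicalClosure := by
  induction n with
  | zero => rwa [derivedSeries_zero, ← MonoidHom.range_eq_map]
  | succ n ih =>
    rw [derivedSeries_succ, Subgroup.map_commutator]
    exact Subgroup.topologicalClosure_minimal _
      ((Subgroup.commutator_mono ih ih).trans (Subgroup.commutator_topologicalClosure_le _))
      (Subgroup.isClosed_topologicalClosure _)

theorem isClosed_closedDerivedSeries {A : Subgroup G} (hA : IsClosed (A : Set G)) (n : ℕ) :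
    IsClosed (closedDerivedSeries A n : Set G) := by
  cases n with
  | zero => exact hA
  | succ n => exact Subgroup.isClosed_topologicalClosure _

theorem closedDerivedSeries_le {A : Subgroup G} (hA : IsClosed (A : Set G)) (n : ℕ) :
    closedDerivedSeries A n ≤ A := by
  induction n with
  | zero => exact le_rfl
  | succ n ih =>
    exact Subgroup.topologicalClosure_minimal _
      ((Subgroup.commutator_mono ih ih).trans (Subgroup.commutator_le_self A)) hA

theorem conj_mem_closedDerivedSeries {A : Subgroup G} {u : G}
    (hu : ∀ a ∈ A, u * a * u⁻¹ ∈ A) (n : ℕ) :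
    ∀ a ∈ closedDerivedSeries A n, u * a * u⁻¹ ∈ closedDerivedSeries A n := by
  induction n with
  | zero => exact hu
  | succ n ih =>
    have hle : ⁅closedDerivedSeries A n, closedDerivedSeries A n⁆ ≤
        (⁅closedDerivedSeries A n, closedDerivedSeries A n⁆).comap
          (MulAut.conj u).toMonoidHom := by
      rw [Subgroup.commutator_le]
      intro a ha b hb
      rw [Subgroup.mem_comap, map_commutatorElement]
      exact Subgroup.commutator_mem_commutator (ih a ha) (ih b hb)
    intro a ha
    refine map_mem_closure (f := fun x : G => u * x * u⁻¹) (by fun_prop) ha ?_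
    exact fun x hx => hle hx

/-- The last nontrivial term of the closed derived series of L ∩ U is compact, abelian and
normalised by U, which the abelian case excludes. -/
theorem InClassS.eq_bot_of_isVirtuallySoluble (hG : InClassS G) {L : Subgroup G}
    (hL : IsLocallyNormal L) (hLs : IsVirtuallySoluble L) : L = ⊥ := by
  classical
  have := hG.totallyDisconnected
  by_contra hL1
  obtain ⟨N, hNf, ⟨n, hn⟩⟩ := hLs
  have hNo : IsOpen (N.topologicalClosure : Set L) := by
    have : N.topologicalClosure.FiniteIndex :=
      Subgroup.finiteIndex_of_le N.le_topologicalClosure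
    exact Subgroup.isOpen_of_isClosed_of_finiteIndex _ N.isClosed_topologicalClosure
  obtain ⟨V, hV, hVN⟩ := Subgroup.exists_nhds_le_map_subtype hNo
  obtain ⟨U, hUo, hUc, hUV, hA1, hAc, hUA⟩ := hG.exists_inf_normalized hL hL1 hV
  have hAN : L ⊓ U ≤ (L.subtype.comp N.subtype).range.topologicalClosure := by
    refine (hVN _ inf_le_left (Set.Subset.trans (inf_le_right : L ⊓ U ≤ U) hUV)).trans ?_
    rintro _ ⟨x, hx, rfl⟩
    refine map_mem_closure (f := fun x : L => (x : G)) continuous_subtype_val hx ?_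
    exact fun y hy => ⟨⟨y, hy⟩, rfl⟩
  have hex : ∃ n, closedDerivedSeries (L ⊓ U) n = ⊥ := by
    refine ⟨n, le_bot_iff.1 ?_⟩
    refine (closedDerivedSeries_le_of_le_topologicalClosure _ hAN n).trans ?_
    rw [hn, Subgroup.map_bot]
    exact Subgroup.topologicalClosure_minimal _ le_rfl isClosed_singleton
  obtain ⟨m, hm, hmin⟩ : ∃ m, closedDerivedSeries (L ⊓ U) (m + 1) = ⊥ ∧
      closedDerivedSeries (L ⊓ U) m ≠ ⊥ := by
    rcases h : Nat.find hex with _ | m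
    · have := Nat.find_spec hex
      rw [h] at this
      exact (hA1 this).elim
    · exact ⟨m, h ▸ Nat.find_spec hex, Nat.find_min hex (by omega)⟩
  refine hmin (hG.eq_bot_of_commutative hUo hUc
    (hAc.of_isClosed_subset (isClosed_closedDerivedSeries hAc.isClosed m)
      (closedDerivedSeries_le hAc.isClosed m))
    (fun u hu => conj_mem_closedDerivedSeries (hUA u hu) m) fun a ha b hb => ?_)
  have h1 : ⁅a, b⁆ ∈ closedDerivedSeries (L ⊓ U) (m + 1) :=
    Subgroup.le_topologicalClosure _ (Subgroup.commutator_mem_commutator ha hb)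
  rw [hm, Subgroup.mem_bot, commutatorElement_eq_one_iff_mul_comm] at h1
  exact h1

end Soluble

theorem mainTheorem2 (G : Type*) [Group G] [TopologicalSpace G] [IsTopologicalGroup G]
    (hG : InClassS G) :
    (∃ η : Set ℕ, η.Finite ∧ (∀ p ∈ η, p.Prime) ∧
      (∀ L : Subgroup G, IsLocallyNormal L → IsVirtuallyPro η L) ∧
      (𝓝 (1 : G)).HasBasis (fun V : Subgroup G => IsOpen (V : Set G) ∧ IsPro η V)
        (fun V : Subgroup G => (V : Set G)) ∧
      (∀ p ∈ η, ∀ L : Subgroup G, IsLocallyNormal L → L ≠ ⊥ →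
        ∃ P : Subgroup G, P ≤ L ∧ Infinite P ∧ IsPro {p} P)) ∧
    ((∃ L : Subgroup G, IsLocallyNormal L ∧ L ≠ ⊥ ∧ IsVirtuallyProsoluble L) →
      ∀ U : Subgroup G, IsCompact (U : Set G) → IsOpen (U : Set G) → IsVirtuallyProsoluble U) ∧
    (∀ L : Subgroup G, IsLocallyNormal L → IsVirtuallySoluble L → L = ⊥) :=
  ⟨⟨localPrimeContent G, hG.exists_isPro_localPrimeContent.1, fun _ hp => hp.1,
    fun _ hL => hG.isVirtuallyPro_localPrimeContent hL, hG.hasBasis_isPro_localPrimeContent,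
    fun _ hp _ hL hL1 => hG.exists_infinite_isPro_singleton hp hL hL1⟩,
    fun ⟨_, hL, hL1, hLs⟩ _ hUc _ => hG.isVirtuallyProsoluble_of_isLocallyNormal hL hL1 hLs hUc,
    fun _ hL hLs => hG.eq_bot_of_isVirtuallySoluble hL hLs⟩
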